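/- Let $N\ge 3$ be an integer, $\alpha\in(-2,0]$, $\lambda\in\mathbb R$ and $\mu<0$. Let $B\subset\mathbb R^N$ be the open unit ball, $\Omega=B$ if $\alpha=0$ and $\Omega=B\setminus\{0\}$ if $\alpha<0$, and let $2^*_\alpha=\frac{2(N+\alpha)}{N-2}$. Let $H^1_0(\Omega)$ be the closure of $C_c^\infty(\Omega)$ in $H^1(\Omega)$, let $H^1_{0,r}(\Omega)$ be its subspace of radial functions, and let $$\lambda_1(\Omega)=\inf_{u\in H^1_{0,r}(\Omega)\setminus\{0\}}\frac{\int_\Omega|\nabla u|^2\,dx}{\int_\Omega u^2\,dx}$$ be the first eigenvalue of $-\Delta$ on $\Omega$ with zero Dirichlet boundary values. Suppose that $$-\frac{(N-2)\mu}{\alpha+2}+\frac{(N-2)\mu}{\alpha+2}\log\left(-\frac{(N-2)\mu}{\alpha+2}\right)+\lambda-\lambda_1(\Omega)\ge 0 .$$ Then the problem $$-\Delta u=|x|^\alpha|u|^{2^*_\alpha-2}u+\mu u\log u^2+\lambda u\ \text{ in }\Omega,\qquad u=0\ \text{ on }\partial\Omega,$$ has no positive solution: there is no $u\in H^1_0(\Omega)$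 (radial or not) with $u>0$ almost everywhere in $\Omega$ for which the right-hand side is in $L^1_{\mathrm{loc}}(\Omega)$ and $$\int_\Omega\nabla u\cdot\nabla\varphi\,dx=\int_\Omega\left(|x|^\alpha|u|^{2^*_\alpha-2}u+\mu u\log u^2+\lambda u\right)\varphi\,dx\qquad\text{for all }\varphi\in C_c^\infty(\Omega).$$ -/

import Mathlib

open MeasureTheory Filter Topology Metric
open scoped ContDiff

namespace HardyHenon

/-- The domain `Ω`: the open unit ball `B` of `ℝ^N` if `α ≥ 0`, and `B \ {0}` if `α < 0`. -/
noncomputable def domain (N : ℕ) (α : ℝ) : Set (EuclideanSpace ℝ (Fin N)) :=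
  if 0 ≤ α then ball 0 1 else ball 0 1 \ {0}

/-- The critical exponent `2(N + α)/(N - 2)`. -/
noncomputable def critExp (N : ℕ) (α : ℝ) : ℝ := 2 * ((N : ℝ) + α) / ((N : ℝ) - 2)

/-- `φ ∈ C_c^∞(Ω)`. -/
def IsTestFunction {N : ℕ} (Ω : Set (EuclideanSpace ℝ (Fin N)))
    (φ : EuclideanSpace ℝ (Fin N) → ℝ) : Prop :=
  ContDiff ℝ ∞ φ ∧ HasCompactSupport φ ∧ tsupport φ ⊆ Ω

/-- `u ∈ H_0^1(Ω)` with (weak) gradient `G`: the pair `(u, G)` is the limit in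
`L²(Ω) × L²(Ω; ℝ^N)` of pairs `(φ n, ∇ (φ n))` with `φ n ∈ C_c^∞(Ω)`. -/
def HasH10Gradient {N : ℕ} (Ω : Set (EuclideanSpace ℝ (Fin N)))
    (u : EuclideanSpace ℝ (Fin N) → ℝ)
    (G : EuclideanSpace ℝ (Fin N) → EuclideanSpace ℝ (Fin N)) : Prop :=
  MemLp u 2 (volume.restrict Ω) ∧ MemLp G 2 (volume.restrict Ω) ∧
  ∃ φ : ℕ → EuclideanSpace ℝ (Fin N) → ℝ,
    (∀ n, IsTestFunction Ω (φ n)) ∧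
    Tendsto (fun n => eLpNorm (fun x => φ n x - u x) 2 (volume.restrict Ω)) atTop (𝓝 0) ∧
    Tendsto (fun n => eLpNorm (fun x => gradient (φ n) x - G x) 2 (volume.restrict Ω))
      atTop (𝓝 0)

/-- `u` is (almost everywhere in `Ω`) a function of `|x|` only. -/
def IsRadial {N : ℕ} (Ω : Set (EuclideanSpace ℝ (Fin N)))
    (u : EuclideanSpace ℝ (Fin N) → ℝ) : Prop :=
  ∃ f : ℝ → ℝ, ∀ᵐ x ∂(volume.restrict Ω), u x = f ‖x‖

/-- The first Dirichlet eigenvalue of `-Δ` on (the radially symmetric set) `Ω`: the infimum of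
the Rayleigh quotient over the nonzero radial functions in `H_0^1(Ω)`. -/
noncomputable def firstEigenvalue {N : ℕ} (Ω : Set (EuclideanSpace ℝ (Fin N))) : ℝ :=
  sInf {q : ℝ | ∃ (u : EuclideanSpace ℝ (Fin N) → ℝ)
      (G : EuclideanSpace ℝ (Fin N) → EuclideanSpace ℝ (Fin N)),
    HasH10Gradient Ω u G ∧ IsRadial Ω u ∧ ¬ (u =ᵐ[volume.restrict Ω] 0) ∧
    q = (∫ x in Ω, ‖G x‖ ^ 2) / (∫ x in Ω, u x ^ 2)}

/-- The nonlinearity `|x|^α |s|^(2*_α - 2) s + μ s log s² + λ s`. -/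
noncomputable def nonlinearity (N : ℕ) (α lam μ : ℝ) (x : EuclideanSpace ℝ (Fin N)) (s : ℝ) : ℝ :=
  ‖x‖ ^ α * |s| ^ (critExp N α - 2) * s + μ * s * Real.log (s ^ 2) + lam * s

/-- `u` is a weak solution of `-Δ u = |x|^α |u|^(2*_α - 2) u + μ u log u² + λ u` in `Ω`, `u = 0`
on `∂Ω`: `u ∈ H_0^1(Ω)`, the right-hand side is locally integrable in `Ω`, and the equation holds
when tested with `C_c^∞(Ω)`. -/
def IsWeakSolution (N : ℕ) (α lam μ : ℝ) (u : EuclideanSpace ℝ (Fin N) → ℝ) : Prop :=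
  ∃ G : EuclideanSpace ℝ (Fin N) → EuclideanSpace ℝ (Fin N),
    HasH10Gradient (domain N α) u G ∧
    LocallyIntegrableOn (fun x => nonlinearity N α lam μ x (u x)) (domain N α) volume ∧
    ∀ φ : EuclideanSpace ℝ (Fin N) → ℝ, IsTestFunction (domain N α) φ →
      ∫ x in domain N α, inner ℝ (G x) (gradient φ x) =
        ∫ x in domain N α, nonlinearity N α lam μ x (u x) * φ x

/-- A weak solution which is positive almost everywhere in `Ω`. -/
def IsPositiveSolution (N : ℕ) (α lam μ : ℝ) (u : EuclideanSpace ℝ (Fin N) → ℝ) : Prop :=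
  IsWeakSolution N α lam μ u ∧ ∀ᵐ x ∂(volume.restrict (domain N α)), 0 < u x

end HardyHenon

/-!
Let `P (|x|²)` be the positive radial first eigenfunction of the unit ball, with eigenvalue `c`.
Multiplying the equation by it and integrating by parts gives, formally, `∫ (f - c u) P = 0`, where
`f` is the right-hand side; the inequality `≤ 0` is all that is used. Since `|x|^α ≥ 1`,
the quotient `f / u` is at least the minimum over `y > 0` of
`y + (μ / k) log y + λ`, `k = (α + 2) / (N - 2)`, `y = u ^ (2 k)` (`mul_le_nonlinearity`), and the
hypothesis says that this minimum is at least the first eigenvalue. So `f ≥ c u`, hence `f = c u`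
almost everywhere, and the pointwise bounds are equalities: `α = 0` and `u` is a positive
constant. A constant satisfies `-Δ u = 0 ≠ c u`, a contradiction (`not_ae_eq_const`).

Three points carry the argument.

* The eigenfunction is explicit: `P s = J (a s)`, where `J` is the entire solution of
  `z J'' + (N / 2) J' + J = 0` (a power series) and `a` its first zero, which exists because a
  positive solution would satisfy a Riccati inequality with finite-time blow-up
  (`exists_bessel_profile_first_zero`). Then `c = 4 a`.
* Only `c ≤ λ₁` is needed, not that the infimum defining `λ₁` is attained. It follows from Picone's
  inequality `⟪∇(φ²/e), ∇e⟫ ≤ |∇φ|²` for test functions `φ`, and density (`le_firstEigenvalue`).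
* No regularity of `u`, at the boundary or at the origin, is needed to test with the eigenfunction
  `e`. One tests with smooth truncations `j (e - ε (1 - log |x|²))`, where `j` is convex,
  nondecreasing, has slope at most `1`, and vanishes on `(-∞, 0]`. The function `1 - log |x|²` is
  superharmonic, positive on the closed ball and infinite at the origin, so these functions are
  compactly supported in the punctured ball and satisfy `-Δ ≤ c e`
  (`neg_radialLaplacian_truncProfile_le`). Positivity of `u` and Fatou's lemma as `ε → 0` then give
  `∫ (f - c u) e ≤ 0` (`ae_eq_mul_of_weak_supersolution`).
-/

namespace HardyHenon

/-! ### The radial profile of the first eigenfunction -/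

/-- The exponential generating function `∑ bₖ zᵏ / k!` of a real sequence. Differentiation shifts
the sequence, so smoothness and linear differential equations can be read off from `b`. -/
noncomputable def expGen (b : ℕ → ℝ) (z : ℝ) : ℝ := ∑' k, b k * (z ^ k / k.factorial)

theorem summable_expGen {b : ℕ → ℝ} (hb : ∀ k, |b k| ≤ 1) (z : ℝ) :
    Summable fun k => b k * (z ^ k / k.factorial) := by
  refine Summable.of_norm_bounded (Real.summable_pow_div_factorial |z|) fun k => ?_
  rw [Real.norm_eq_abs, abs_mul, abs_div, abs_pow, Nat.abs_cast]
  exact mul_le_of_le_one_left (by positivity) (hb k)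

theorem expGen_zero (b : ℕ → ℝ) : expGen b 0 = b 0 := by
  unfold expGen
  rw [tsum_eq_single 0]
  · simp
  · intro k hk
    simp [hk]

theorem succ_mul_pow_div_factorial (k : ℕ) (z : ℝ) :
    ((k + 1 : ℕ) : ℝ) * z ^ k / (k + 1).factorial = z ^ k / k.factorial := by
  rw [Nat.factorial_succ]
  push_cast
  have : (k.factorial : ℝ) ≠ 0 := by positivity
  have : (k : ℝ) + 1 ≠ 0 := by positivity
  field_simp

theorem hasDerivAt_expGen {b : ℕ → ℝ} (hb : ∀ k, |b k| ≤ 1) (z : ℝ) :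
    HasDerivAt (expGen b) (expGen (fun k => b (k + 1)) z) z := by
  set R := |z| + 1
  have hu : Summable fun k : ℕ => (k : ℝ) * R ^ (k - 1) / k.factorial := by
    rw [← summable_nat_add_iff 1]
    simpa [succ_mul_pow_div_factorial, -Nat.cast_add] using Real.summable_pow_div_factorial R
  have key := hasDerivAt_tsum_of_isPreconnected (y := z) (y₀ := 0) (t := ball (0 : ℝ) R)
    (g := fun k z => b k * (z ^ k / k.factorial))
    (g' := fun k z => b k * (k * z ^ (k - 1) / k.factorial)) hu isOpen_ball
    (convex_ball _ _).isPreconnected ?_ ?_ (by simp [R]; positivity) (summable_expGen hb 0)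
    (by simp [R])
  · have hs : Summable fun k : ℕ => b k * (k * z ^ (k - 1) / k.factorial) := by
      rw [← summable_nat_add_iff 1]
      simpa [succ_mul_pow_div_factorial, -Nat.cast_add] using
        summable_expGen (b := fun k => b (k + 1)) (fun k => hb _) z
    rw [hs.tsum_eq_zero_add] at key
    simp only [succ_mul_pow_div_factorial, Nat.cast_zero, zero_mul, zero_div, mul_zero, zero_add,
      add_tsub_cancel_right] at key
    exact key
  · intro k y _
    exact ((hasDerivAt_pow k y).div_const _).const_mul _
  · intro k y hy
    have hy' : |y| ≤ R := by simpa using (mem_ball_zero_iff.1 hy).le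
    rw [Real.norm_eq_abs, abs_mul, abs_div, abs_mul, abs_pow, Nat.abs_cast, Nat.abs_cast]
    refine (mul_le_of_le_one_left (by positivity) (hb k)).trans ?_
    gcongr

theorem deriv_expGen {b : ℕ → ℝ} (hb : ∀ k, |b k| ≤ 1) :
    deriv (expGen b) = expGen fun k => b (k + 1) :=
  funext fun z => (hasDerivAt_expGen hb z).deriv

theorem contDiff_expGen {b : ℕ → ℝ} (hb : ∀ k, |b k| ≤ 1) : ContDiff ℝ ∞ (expGen b) := by
  rw [contDiff_infty]
  intro n
  induction n generalizing b with
  | zero =>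
    exact contDiff_zero.2 (continuous_iff_continuousAt.2
      fun z => (hasDerivAt_expGen hb z).continuousAt)
  | succ n ih =>
    push_cast
    rw [contDiff_succ_iff_deriv, deriv_expGen hb]
    exact ⟨fun z => (hasDerivAt_expGen hb z).differentiableAt, by simp, ih fun k => hb _⟩

/-- The hypergeometric series `₀F₁(; ν; -z)` solves `z J'' + ν J' + J = 0`. -/
theorem exists_bessel_profile {ν : ℝ} (hν : 1 ≤ ν) :
    ∃ J : ℝ → ℝ, ContDiff ℝ ∞ J ∧ J 0 = 1 ∧
      ∀ z, z * deriv (deriv J) z + ν * deriv J z + J z = 0 := by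
  let b : ℕ → ℝ := fun k => ∏ i ∈ Finset.range k, (-(ν + i)⁻¹)
  have hb : ∀ k, |b k| ≤ 1 := by
    intro k
    simp only [b, Finset.abs_prod]
    refine Finset.prod_le_one (fun i _ => abs_nonneg _) fun i _ => ?_
    rw [abs_neg, abs_of_nonneg (by positivity)]
    exact inv_le_one_of_one_le₀ (by linarith [(Nat.cast_nonneg i : (0 : ℝ) ≤ i)])
  have hrec : ∀ k : ℕ, (ν + k) * b (k + 1) = - b k := by
    intro k
    simp only [b, Finset.prod_range_succ]
    have : ν + k ≠ 0 := by positivity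
    field_simp
  refine ⟨expGen b, contDiff_expGen hb, by simp [expGen_zero, b], fun z => ?_⟩
  rw [deriv_expGen hb, deriv_expGen fun k => hb _]
  have h1 : z * expGen (fun k => b (k + 1 + 1)) z
      = ∑' k : ℕ, k * b (k + 1) * (z ^ k / k.factorial) := by
    have hterm : ∀ k : ℕ, ((k + 1 : ℕ) : ℝ) * b (k + 1 + 1) * (z ^ (k + 1) / (k + 1).factorial)
        = z * (b (k + 1 + 1) * (z ^ k / k.factorial)) := by
      intro k
      linear_combination (b (k + 1 + 1) * z) * succ_mul_pow_div_factorial k z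
    have hs : Summable fun k : ℕ => (k : ℝ) * b (k + 1) * (z ^ k / k.factorial) := by
      rw [← summable_nat_add_iff 1]
      simp_rw [hterm]
      exact (summable_expGen (b := fun k => b (k + 1 + 1)) (fun k => hb _) z).mul_left z
    rw [hs.tsum_eq_zero_add]
    simp_rw [hterm]
    simp [expGen, tsum_mul_left]
  have hs1 := (summable_expGen (b := fun k => b (k + 1)) (fun k => hb _) z).mul_left ν
  have hs0 := summable_expGen hb z
  rw [h1, expGen, expGen, ← tsum_mul_left]
  have hs2 : Summable fun k : ℕ => (k : ℝ) * b (k + 1) * (z ^ k / k.factorial) := by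
    refine ((hs1.add hs0).neg).congr fun k => ?_
    linear_combination (-(z ^ k / k.factorial)) * hrec k
  rw [← hs2.tsum_add hs1, ← (hs2.add hs1).tsum_add hs0]
  refine (tsum_congr fun k => ?_).trans tsum_zero
  linear_combination (z ^ k / k.factorial) * hrec k

/-- A solution of `z J'' + ν J' + J = 0` that stays positive is decreasing at an exponential rate:
`J' ≤ - J / ν`. -/
theorem deriv_bounds_of_pos {ν : ℝ} (hν : 1 ≤ ν) {J : ℝ → ℝ} (hJ : ContDiff ℝ ∞ J)
    (hode : ∀ z, z * deriv (deriv J) z + ν * deriv J z + J z = 0)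
    (hpos : ∀ z, 0 ≤ z → 0 < J z) {z : ℝ} (hz : 0 < z) :
    deriv J z < 0 ∧ ν * deriv J z + J z ≤ 0 := by
  have hJ' : ContDiff ℝ ∞ (deriv J) := (contDiff_infty_iff_deriv.1 hJ).2
  have hd1 : ∀ z, HasDerivAt J (deriv J z) z := fun z =>
    (hJ.differentiable (by simp) z).hasDerivAt
  have hd2 : ∀ z, HasDerivAt (deriv J) (deriv (deriv J) z) z := fun z =>
    (hJ'.differentiable (by simp) z).hasDerivAt
  have hpd : ∀ z : ℝ, 0 < z → HasDerivAt (fun z : ℝ => z ^ ν) (ν * z ^ (ν - 1)) z := fun z hz =>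
    Real.hasDerivAt_rpow_const (Or.inl hz.ne')
  have hpm : ∀ z : ℝ, 0 < z → z ^ ν = z ^ (ν - 1) * z := fun z hz => by
    rw [← Real.rpow_add_one hz.ne']; simp
  have hpc : Continuous fun z : ℝ => z ^ ν := Real.continuous_rpow_const (by linarith)
  -- `z^ν J'` vanishes at the origin and has derivative `- z^(ν-1) J`.
  have hneg : ∀ z, 0 < z → deriv J z < 0 := by
    have hder : ∀ z, 0 < z → HasDerivAt (fun z => z ^ ν * deriv J z) (-(z ^ (ν - 1) * J z)) z := by
      intro z hz
      convert! (hpd z hz).mul (hd2 z) using 1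
      rw [hpm z hz]
      linear_combination (-z ^ (ν - 1)) * hode z
    have hanti : StrictAntiOn (fun z => z ^ ν * deriv J z) (Set.Ici 0) := by
      refine strictAntiOn_of_deriv_neg (convex_Ici 0) (hpc.mul hJ'.continuous).continuousOn ?_
      intro z hz
      rw [interior_Ici] at hz
      rw [(hder z hz).deriv]
      have := Real.rpow_pos_of_pos hz (ν - 1)
      have := hpos z (le_of_lt hz)
      simp only [Left.neg_neg_iff]
      positivity
    intro z hz
    have := hanti Set.self_mem_Ici hz.le hz
    simp only [Real.zero_rpow (by linarith : ν ≠ 0), zero_mul] at this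
    exact (pos_iff_neg_of_mul_neg this).1 (Real.rpow_pos_of_pos hz ν)
  refine ⟨hneg z hz, ?_⟩
  -- `z^ν (ν J' + J)` vanishes at the origin and has derivative `z^ν J'`.
  have hder : ∀ z, 0 < z →
      HasDerivAt (fun z => z ^ ν * (ν * deriv J z + J z)) (z ^ ν * deriv J z) z := by
    intro z hz
    convert! (hpd z hz).mul (((hd2 z).const_mul ν).add (hd1 z)) using 1
    simp only [Pi.add_apply]
    rw [hpm z hz]
    linear_combination (-ν * z ^ (ν - 1)) * hode z
  have hanti : AntitoneOn (fun z => z ^ ν * (ν * deriv J z + J z)) (Set.Ici 0) := by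
    refine antitoneOn_of_deriv_nonpos (convex_Ici 0)
      (hpc.mul ((continuous_const.mul hJ'.continuous).add hJ.continuous)).continuousOn ?_ ?_
    · intro z hz
      rw [interior_Ici] at hz
      exact (hder z hz).differentiableAt.differentiableWithinAt
    · intro z hz
      rw [interior_Ici] at hz
      rw [(hder z hz).deriv]
      have := Real.rpow_pos_of_pos hz ν
      have := hneg z hz
      nlinarith
  have := hanti Set.self_mem_Ici hz.le hz.le
  simp only [Real.zero_rpow (by linarith : ν ≠ 0), zero_mul] at this
  exact nonpos_of_mul_nonpos_right this (Real.rpow_pos_of_pos hz ν)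

/-- A positive solution of `z J'' + ν J' + J = 0` on the half line cannot exist: the function
`h = - J / J'` would be positive and satisfy the Riccati inequality `h' ≤ - 1/2` for large `z`. -/
theorem exists_nonpos_of_ode {ν : ℝ} (hν : 1 ≤ ν) {J : ℝ → ℝ} (hJ : ContDiff ℝ ∞ J)
    (hode : ∀ z, z * deriv (deriv J) z + ν * deriv J z + J z = 0) :
    ∃ z, 0 ≤ z ∧ J z ≤ 0 := by
  by_contra! hpos
  have hJ' : ContDiff ℝ ∞ (deriv J) := (contDiff_infty_iff_deriv.1 hJ).2
  have hd1 : ∀ z, HasDerivAt J (deriv J z) z := fun z =>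
    (hJ.differentiable (by simp) z).hasDerivAt
  have hd2 : ∀ z, HasDerivAt (deriv J) (deriv (deriv J) z) z := fun z =>
    (hJ'.differentiable (by simp) z).hasDerivAt
  have hb : ∀ z, 0 < z → deriv J z < 0 ∧ ν * deriv J z + J z ≤ 0 :=
    fun z hz => deriv_bounds_of_pos hν hJ hode hpos hz
  set A := 2 * ν ^ 2
  have hA : 0 < A := by positivity
  have hder : ∀ z, A ≤ z → HasDerivAt (fun z => -(J z / deriv J z) + z / 2)
      (-((deriv J z * deriv J z - J z * deriv (deriv J) z) / deriv J z ^ 2) + 1 / 2) z := by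
    intro z hz
    exact (((hd1 z).div (hd2 z) (hb z (hA.trans_le hz)).1.ne).neg).add ((hasDerivAt_id z).div_const 2)
  have hanti : AntitoneOn (fun z => -(J z / deriv J z) + z / 2) (Set.Ici A) := by
    refine antitoneOn_of_deriv_nonpos (convex_Ici A)
      (fun z hz => (hder z hz).continuousAt.continuousWithinAt)
      (fun z hz => (hder z (interior_subset hz)).differentiableAt.differentiableWithinAt) ?_
    intro z hz
    have hz : A ≤ z := interior_subset hz
    have hz0 : 0 < z := hA.trans_le hz
    obtain ⟨h1, h2⟩ := hb z hz0
    have h3 := hpos z hz0.le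
    have h4 := hode z
    rw [(hder z hz).deriv]
    have h5 : deriv J z ^ 2 / 2 ≤ deriv J z * deriv J z - J z * deriv (deriv J) z := by
      have h6 : -(J z * deriv (deriv J) z) * z = J z * (ν * deriv J z + J z) := by
        linear_combination (-J z) * h4
      have h7 : 0 ≤ (deriv J z ^ 2 / 2 - J z * deriv (deriv J) z) * z := by
        have h8 : (deriv J z ^ 2 / 2 - J z * deriv (deriv J) z) * z
            = deriv J z ^ 2 / 2 * z + J z * (ν * deriv J z + J z) := by linear_combination h6
        rw [h8]
        have h9 : deriv J z ^ 2 / 2 * A ≤ deriv J z ^ 2 / 2 * z := by gcongr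
        have h10 : deriv J z ^ 2 / 2 * A = (ν * deriv J z) ^ 2 := by simp only [A]; ring
        have h11 : J z * (-(ν * deriv J z)) ≤ (-(ν * deriv J z)) * (-(ν * deriv J z)) := by
          apply mul_le_mul_of_nonneg_right (by linarith)
          nlinarith
        nlinarith [sq_nonneg (J z)]
      have := nonneg_of_mul_nonneg_left h7 hz0
      nlinarith
    have h6 : 1 / 2 ≤ (deriv J z * deriv J z - J z * deriv (deriv J) z) / deriv J z ^ 2 := by
      rw [le_div_iff₀ (sq_pos_of_neg h1)]
      linarith
    linarith
  let h0 := -(J A / deriv J A) + A / 2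
  have hz : A ≤ max A (2 * h0) := le_max_left _ _
  have h1 := hanti Set.self_mem_Ici hz hz
  have h2 : J (max A (2 * h0)) / deriv J (max A (2 * h0)) < 0 :=
    div_neg_of_pos_of_neg (hpos _ (hA.le.trans hz)) (hb _ (hA.trans_le hz)).1
  have h3 := le_max_right A (2 * h0)
  simp only [h0] at h1 h2 h3
  linarith

/-- The profile `J` and its first zero `a`: the function `x ↦ J (a |x|²)` is a positive radial
eigenfunction of the unit ball for the eigenvalue `4 a`, when `ν = N / 2`. -/
theorem exists_bessel_profile_first_zero {ν : ℝ} (hν : 1 ≤ ν) :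
    ∃ (J : ℝ → ℝ) (a : ℝ), 0 < a ∧ ContDiff ℝ ∞ J ∧
      (∀ z, z * deriv (deriv J) z + ν * deriv J z + J z = 0) ∧ J a = 0 ∧
      ∀ z, 0 ≤ z → z < a → 0 < J z := by
  obtain ⟨J, hJ, h0, hode⟩ := exists_bessel_profile hν
  have hzero : ∀ z, 0 ≤ z → J z ≤ 0 → ∃ y, 0 ≤ y ∧ y ≤ z ∧ J y = 0 := by
    intro z hz hJz
    obtain ⟨y, hy, hy0⟩ := intermediate_value_Icc' hz hJ.continuous.continuousOn
      (show (0 : ℝ) ∈ Set.Icc (J z) (J 0) from ⟨hJz, by simp [h0]⟩)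
    exact ⟨y, hy.1, hy.2, hy0⟩
  let Z : Set ℝ := {z | 0 ≤ z ∧ J z = 0}
  have hZne : Z.Nonempty := by
    obtain ⟨z, hz, hJz⟩ := exists_nonpos_of_ode hν hJ hode
    obtain ⟨y, hy, -, hy0⟩ := hzero z hz hJz
    exact ⟨y, hy, hy0⟩
  have hZb : BddBelow Z := ⟨0, fun z hz => hz.1⟩
  have hZc : IsClosed Z :=
    (isClosed_le continuous_const continuous_id).inter
      (isClosed_eq hJ.continuous continuous_const)
  have hmem : sInf Z ∈ Z := hZc.csInf_mem hZne hZb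
  refine ⟨J, sInf Z, ?_, hJ, hode, hmem.2, fun z hz hza => ?_⟩
  · refine lt_of_le_of_ne hmem.1 fun h => ?_
    have := hmem.2
    rw [← h, h0] at this
    exact one_ne_zero this
  · by_contra! hJz
    obtain ⟨y, hy, hyz, hy0⟩ := hzero z hz hJz
    exact absurd (csInf_le hZb ⟨hy, hy0⟩) (not_le.2 (hyz.trans_lt hza))

/-! ### Radial functions and integration by parts -/

/-- The function `x ↦ g (|x|²)`. The variable `s = |x|²` keeps radial functions smooth at the
origin as soon as `g` is smooth. -/
noncomputable def radialFun (N : ℕ) (g : ℝ → ℝ) (x : EuclideanSpace ℝ (Fin N)) : ℝ := g (‖x‖ ^ 2)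

/-- The Laplacian of `x ↦ g (|x|²)` on `ℝ^N`, as a function of `s = |x|²`. -/
noncomputable def radialLaplacian (N : ℕ) (g : ℝ → ℝ) (s : ℝ) : ℝ :=
  4 * s * deriv (deriv g) s + 2 * N * deriv g s

theorem contDiff_radialFun {N : ℕ} {g : ℝ → ℝ} (hg : ContDiff ℝ ∞ g) :
    ContDiff ℝ ∞ (radialFun N g) := by
  exact hg.comp (contDiff_norm_sq ℝ)

theorem continuous_radialLaplacian {N : ℕ} {g : ℝ → ℝ} (hg : ContDiff ℝ ∞ g) :
    Continuous (radialLaplacian N g) := by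
  have h1 := (contDiff_infty_iff_deriv.1 hg).2
  have h2 := (contDiff_infty_iff_deriv.1 h1).2
  have := h1.continuous
  have := h2.continuous
  unfold radialLaplacian
  fun_prop

theorem fderiv_radialFun {N : ℕ} {g : ℝ → ℝ} (hg : ContDiff ℝ ∞ g)
    (x v : EuclideanSpace ℝ (Fin N)) :
    fderiv ℝ (radialFun N g) x v = 2 * deriv g (‖x‖ ^ 2) * inner ℝ x v := by
  have h := ((hg.differentiable (by simp) (‖x‖ ^ 2)).hasDerivAt).comp_hasFDerivAt x
    (hasStrictFDerivAt_norm_sq x).hasFDerivAt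
  have h' : HasFDerivAt (radialFun N g) _ x := h
  rw [h'.fderiv]
  simp
  ring

theorem inner_gradient_right {N : ℕ} (q : EuclideanSpace ℝ (Fin N) → ℝ)
    (v x : EuclideanSpace ℝ (Fin N)) : inner ℝ v (gradient q x) = fderiv ℝ q x v := by
  rw [real_inner_comm, gradient, InnerProductSpace.toDual_symm_apply]

theorem continuous_gradient {N : ℕ} {q : EuclideanSpace ℝ (Fin N) → ℝ} (hq : ContDiff ℝ ∞ q) :
    Continuous (gradient q) :=
  (InnerProductSpace.toDual ℝ _).symm.continuous.comp (hq.continuous_fderiv (by simp))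

theorem hasCompactSupport_gradient {N : ℕ} {q : EuclideanSpace ℝ (Fin N) → ℝ}
    (hq : HasCompactSupport q) : HasCompactSupport (gradient q) :=
  (hq.fderiv ℝ).comp_left (g := (InnerProductSpace.toDual ℝ _).symm) (by simp)

theorem gradient_eq_zero_of_notMem_tsupport {N : ℕ} {q : EuclideanSpace ℝ (Fin N) → ℝ}
    {x : EuclideanSpace ℝ (Fin N)} (hx : x ∉ tsupport q) : gradient q x = 0 := by
  have h : fderiv ℝ q x = 0 := by
    by_contra h
    exact hx (support_fderiv_subset ℝ h)
  simp [gradient, h]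

/-- Green's formula for two smooth functions one of which has compact support. -/
theorem integral_inner_gradient_eq {N : ℕ} {p q : EuclideanSpace ℝ (Fin N) → ℝ}
    (hp : ContDiff ℝ ∞ p) (hq : ContDiff ℝ ∞ q) (hc : HasCompactSupport p ∨ HasCompactSupport q) :
    ∫ x, inner ℝ (gradient p x) (gradient q x) =
      -∫ x, p x * ∑ i, fderiv ℝ (fun y => fderiv ℝ q y (EuclideanSpace.single i 1)) x
        (EuclideanSpace.single i 1) := by
  let e : Fin N → EuclideanSpace ℝ (Fin N) := fun i => EuclideanSpace.single i 1
  have hV : ∀ i, ContDiff ℝ ∞ fun y => fderiv ℝ q y (e i) := fun i =>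
    (hq.fderiv_right (m := ∞) (by simp)).clm_apply contDiff_const
  have hpc : ∀ i, Continuous fun y => fderiv ℝ p y (e i) := fun i =>
    (hp.continuous_fderiv (by simp)).clm_apply continuous_const
  have hVc : ∀ i, Continuous fun x => fderiv ℝ (fun y => fderiv ℝ q y (e i)) x (e i) := fun i =>
    ((hV i).continuous_fderiv (by simp)).clm_apply continuous_const
  have hI1 : ∀ i, Integrable fun x => fderiv ℝ p x (e i) * fderiv ℝ q x (e i) := fun i => by
    refine ((hpc i).mul (hV i).continuous).integrable_of_hasCompactSupport ?_
    rcases hc with h | h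
    · exact (h.fderiv_apply ℝ (e i)).mul_right
    · exact (h.fderiv_apply ℝ (e i)).mul_left
  have hI2 : ∀ i, Integrable fun x =>
      p x * fderiv ℝ (fun y => fderiv ℝ q y (e i)) x (e i) := fun i => by
    refine (hp.continuous.mul (hVc i)).integrable_of_hasCompactSupport ?_
    rcases hc with h | h
    · exact h.mul_right
    · exact ((h.fderiv_apply ℝ (e i)).fderiv_apply ℝ (e i)).mul_left
  have hI3 : ∀ i, Integrable fun x => p x * fderiv ℝ q x (e i) := fun i => by
    refine (hp.continuous.mul (hV i).continuous).integrable_of_hasCompactSupport ?_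
    rcases hc with h | h
    · exact h.mul_right
    · exact (h.fderiv_apply ℝ (e i)).mul_left
  have hpt : ∀ x, inner ℝ (gradient p x) (gradient q x)
      = ∑ i, fderiv ℝ p x (e i) * fderiv ℝ q x (e i) := fun x => by
    rw [PiLp.inner_apply]
    refine Finset.sum_congr rfl fun i _ => ?_
    rw [← inner_gradient_right p, ← inner_gradient_right q, EuclideanSpace.inner_single_left,
      EuclideanSpace.inner_single_left]
    simp [mul_comm]
  simp_rw [hpt, Finset.mul_sum]
  rw [integral_finsetSum _ fun i _ => hI1 i, integral_finsetSum _ fun i _ => hI2 i,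
    ← Finset.sum_neg_distrib]
  refine Finset.sum_congr rfl fun i _ => ?_
  rw [integral_mul_fderiv_eq_neg_fderiv_mul_of_integrable (hI1 i) (hI2 i) (hI3 i)
    (fun x _ => hp.differentiable (by simp) x) (fun x _ => (hV i).differentiable (by simp) x),
    neg_neg]

theorem sum_fderiv_fderiv_radialFun {N : ℕ} {g : ℝ → ℝ} (hg : ContDiff ℝ ∞ g)
    (x : EuclideanSpace ℝ (Fin N)) :
    ∑ i, fderiv ℝ (fun y => fderiv ℝ (radialFun N g) y (EuclideanSpace.single i 1)) x
      (EuclideanSpace.single i 1) = radialLaplacian N g (‖x‖ ^ 2) := by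
  have hg' : ContDiff ℝ ∞ (deriv g) := (contDiff_infty_iff_deriv.1 hg).2
  have h : ∀ i : Fin N,
      fderiv ℝ (fun y => fderiv ℝ (radialFun N g) y (EuclideanSpace.single i 1)) x
        (EuclideanSpace.single i 1)
      = 4 * deriv (deriv g) (‖x‖ ^ 2) * x i ^ 2 + 2 * deriv g (‖x‖ ^ 2) := by
    intro i
    have h1 : (fun y => fderiv ℝ (radialFun N g) y (EuclideanSpace.single i 1))
        = fun y => (2 * radialFun N (deriv g) y) * inner ℝ y (EuclideanSpace.single i (1 : ℝ)) := by
      funext y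
      rw [fderiv_radialFun hg]
      rfl
    have hd1 : DifferentiableAt ℝ (fun y => 2 * radialFun N (deriv g) y) x :=
      (((contDiff_radialFun hg').differentiable (by simp)) x).const_mul 2
    have hd2 : DifferentiableAt ℝ
        (fun y : EuclideanSpace ℝ (Fin N) => inner ℝ y (EuclideanSpace.single i (1 : ℝ))) x := by
      exact differentiableAt_fun_id.inner ℝ (differentiableAt_const _)
    rw [h1, fderiv_fun_mul hd1 hd2,
      fderiv_const_mul (((contDiff_radialFun hg').differentiable (by simp)) x)]
    simp only [add_apply, smul_apply, smul_eq_mul]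
    rw [fderiv_radialFun hg', fderiv_inner_apply ℝ differentiableAt_fun_id (differentiableAt_const _)]
    simp [radialFun, EuclideanSpace.inner_single_right]
    ring
  simp_rw [h, Finset.sum_add_distrib, ← Finset.mul_sum]
  rw [radialLaplacian, EuclideanSpace.real_norm_sq_eq]
  simp
  ring

theorem radialLaplacian_eq_zero_of_notMem_tsupport {N : ℕ} {g : ℝ → ℝ} (hg : ContDiff ℝ ∞ g)
    {x : EuclideanSpace ℝ (Fin N)} (hx : x ∉ tsupport (radialFun N g)) :
    radialLaplacian N g (‖x‖ ^ 2) = 0 := by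
  rw [← sum_fderiv_fderiv_radialFun hg]
  refine Finset.sum_eq_zero fun i _ => ?_
  by_contra h
  exact hx ((tsupport_fderiv_apply_subset ℝ (f := radialFun N g) (EuclideanSpace.single i 1))
    (tsupport_fderiv_apply_subset ℝ _ (subset_tsupport _ h)))

/-- Green's formula against a radial function. -/
theorem integral_inner_gradient_radialFun {N : ℕ} {p : EuclideanSpace ℝ (Fin N) → ℝ} {g : ℝ → ℝ}
    (hp : ContDiff ℝ ∞ p) (hg : ContDiff ℝ ∞ g)
    (hc : HasCompactSupport p ∨ HasCompactSupport (radialFun N g)) :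
    ∫ x, inner ℝ (gradient p x) (gradient (radialFun N g) x) =
      -∫ x, p x * radialLaplacian N g (‖x‖ ^ 2) := by
  rw [integral_inner_gradient_eq hp (contDiff_radialFun hg) hc]
  simp_rw [sum_fderiv_fderiv_radialFun hg]

/-! ### Test functions -/

theorem domain_subset_ball (N : ℕ) (α : ℝ) : domain N α ⊆ ball 0 1 := by
  unfold domain
  split_ifs
  exacts [subset_rfl, Set.sdiff_subset]

theorem mem_domain {N : ℕ} {α : ℝ} {x : EuclideanSpace ℝ (Fin N)} (h0 : x ≠ 0) (h1 : ‖x‖ < 1) :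
    x ∈ domain N α := by
  unfold domain
  split_ifs <;> simp [h0, h1]

theorem isOpen_domain (N : ℕ) (α : ℝ) : IsOpen (domain N α) := by
  unfold domain
  split_ifs
  exacts [isOpen_ball, isOpen_ball.sdiff isClosed_singleton]

theorem measurableSet_domain (N : ℕ) (α : ℝ) : MeasurableSet (domain N α) :=
  (isOpen_domain N α).measurableSet

theorem IsTestFunction.eq_zero {N : ℕ} {Ω : Set (EuclideanSpace ℝ (Fin N))}
    {φ : EuclideanSpace ℝ (Fin N) → ℝ} (hφ : IsTestFunction Ω φ) {x : EuclideanSpace ℝ (Fin N)}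
    (hx : x ∉ Ω) : φ x = 0 :=
  image_eq_zero_of_notMem_tsupport fun h => hx (hφ.2.2 h)

theorem IsTestFunction.gradient_eq_zero {N : ℕ} {Ω : Set (EuclideanSpace ℝ (Fin N))}
    {φ : EuclideanSpace ℝ (Fin N) → ℝ} (hφ : IsTestFunction Ω φ) {x : EuclideanSpace ℝ (Fin N)}
    (hx : x ∉ Ω) : gradient φ x = 0 :=
  gradient_eq_zero_of_notMem_tsupport fun h => hx (hφ.2.2 h)

theorem IsTestFunction.memLp {N : ℕ} {Ω : Set (EuclideanSpace ℝ (Fin N))}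
    {φ : EuclideanSpace ℝ (Fin N) → ℝ} (hφ : IsTestFunction Ω φ) :
    MemLp φ 2 (volume.restrict Ω) :=
  (hφ.1.continuous.memLp_of_hasCompactSupport hφ.2.1).restrict Ω

theorem IsTestFunction.memLp_gradient {N : ℕ} {Ω : Set (EuclideanSpace ℝ (Fin N))}
    {φ : EuclideanSpace ℝ (Fin N) → ℝ} (hφ : IsTestFunction Ω φ) :
    MemLp (gradient φ) 2 (volume.restrict Ω) :=
  ((continuous_gradient hφ.1).memLp_of_hasCompactSupport
    (hasCompactSupport_gradient hφ.2.1)).restrict Ω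

theorem IsTestFunction.hasH10Gradient {N : ℕ} {Ω : Set (EuclideanSpace ℝ (Fin N))}
    {φ : EuclideanSpace ℝ (Fin N) → ℝ} (hφ : IsTestFunction Ω φ) :
    HasH10Gradient Ω φ (gradient φ) :=
  ⟨hφ.memLp, hφ.memLp_gradient, fun _ => φ, fun _ => hφ, by simp, by simp⟩

/-- The support of the radial functions used for testing is a closed annulus, so they are admissible
whether or not the origin belongs to the domain. -/
theorem isTestFunction_radialFun (N : ℕ) (α : ℝ) {g : ℝ → ℝ} (hg : ContDiff ℝ ∞ g) {s₁ s₂ : ℝ}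
    (h1 : 0 < s₁) (h2 : s₂ < 1) (h0 : ∀ s, s ∉ Set.Icc s₁ s₂ → g s = 0) :
    IsTestFunction (domain N α) (radialFun N g) := by
  let T : Set (EuclideanSpace ℝ (Fin N)) := {x | ‖x‖ ^ 2 ∈ Set.Icc s₁ s₂}
  have hTc : IsClosed T := isClosed_Icc.preimage (by fun_prop)
  have hT1 : ∀ x ∈ T, ‖x‖ < 1 := fun x hx => by
    have : ‖x‖ ^ 2 ≤ s₂ := hx.2
    exact (sq_lt_one_iff₀ (norm_nonneg x)).1 (this.trans_lt h2)
  have hTK : IsCompact T := isCompact_of_isClosed_isBounded hTc <|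
    isBounded_ball.subset fun x hx => mem_ball_zero_iff.2 (hT1 x hx)
  have hz : ∀ x, x ∉ T → radialFun N g x = 0 := fun x hx => h0 _ hx
  refine ⟨contDiff_radialFun hg, HasCompactSupport.intro hTK hz, ?_⟩
  have hsub : Function.support (radialFun N g) ⊆ T := fun x hx => not_not.1 fun h => hx (hz x h)
  refine (closure_minimal hsub hTc).trans fun x hx => ?_
  refine mem_domain (fun h => ?_) (hT1 x hx)
  have : s₁ ≤ ‖x‖ ^ 2 := hx.1
  rw [h] at this
  simp at this
  linarith

/-- There is a nonnegative, nonzero radial test function. -/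
theorem exists_radial_bump (N : ℕ) (hN : N ≠ 0) (α : ℝ) :
    ∃ g : ℝ → ℝ, ContDiff ℝ ∞ g ∧ (∀ s, 0 ≤ g s) ∧ IsTestFunction (domain N α) (radialFun N g) ∧
      ∃ x ∈ domain N α, radialFun N g x ≠ 0 := by
  let b : ContDiffBump (1 / 2 : ℝ) := ⟨1 / 8, 1 / 4, by norm_num, by norm_num⟩
  refine ⟨b, b.contDiff, fun s => b.nonneg, ?_, ?_⟩
  · refine isTestFunction_radialFun N α b.contDiff (s₁ := 1 / 4) (s₂ := 3 / 4) (by norm_num)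
      (by norm_num) fun s hs => b.zero_of_le_dist ?_
    show (1 / 4 : ℝ) ≤ |s - 1 / 2|
    by_contra! h
    rw [abs_lt] at h
    exact hs ⟨by linarith, by linarith⟩
  · have : NeZero N := ⟨hN⟩
    let x : EuclideanSpace ℝ (Fin N) := EuclideanSpace.single 0 √(1 / 2)
    have hx : ‖x‖ ^ 2 = 1 / 2 := by
      simp only [x, PiLp.norm_single, Real.norm_eq_abs, sq_abs]
      exact Real.sq_sqrt (by norm_num)
    refine ⟨x, mem_domain (fun h => ?_) ?_, ?_⟩
    · rw [h] at hx
      norm_num at hx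
    · exact (sq_lt_one_iff₀ (norm_nonneg x)).1 (by rw [hx]; norm_num)
    · rw [radialFun, hx, b.one_of_mem_closedBall (by simp [b])]
      exact one_ne_zero

/-! ### Passing to the limit in the definition of `H¹₀` -/

theorem tendsto_integral_inner_of_eLpNorm {X F : Type*} [MeasurableSpace X] {m : Measure X}
    [IsFiniteMeasure m] [NormedAddCommGroup F] [InnerProductSpace ℝ F] {f : ℕ → X → F} {f₀ K : X → F}
    (hf : ∀ n, MemLp (f n) 2 m) (hf₀ : MemLp f₀ 2 m) (hK : AEStronglyMeasurable K m) {C : ℝ}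
    (hKC : ∀ x, ‖K x‖ ≤ C)
    (h : Tendsto (fun n => eLpNorm (fun x => f n x - f₀ x) 2 m) atTop (𝓝 0)) :
    Tendsto (fun n => ∫ x, inner ℝ (f n x) (K x) ∂m) atTop (𝓝 (∫ x, inner ℝ (f₀ x) (K x) ∂m)) := by
  have hint : ∀ {p : X → F}, MemLp p 2 m → Integrable (fun x => inner ℝ (p x) (K x)) m := by
    intro p hp
    refine Integrable.mono' ((hp.integrable (by norm_num)).norm.mul_const C)
      (hp.1.inner hK) (ae_of_all _ fun x => ?_)
    exact (norm_inner_le_norm _ _).trans (by gcongr; exact hKC x)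
  refine tendsto_integral_of_L1' _ (hint hf₀).1
    (Eventually.of_forall fun n => hint (hf n)) ?_
  have hbound : ∀ n, eLpNorm ((fun x => inner ℝ (f n x) (K x)) - fun x => inner ℝ (f₀ x) (K x)) 1 m
      ≤ ENNReal.ofReal C * (eLpNorm (fun x => f n x - f₀ x) 2 m *
        m Set.univ ^ (1 / (1 : ENNReal).toReal - 1 / (2 : ENNReal).toReal)) := by
    intro n
    refine (eLpNorm_le_mul_eLpNorm_of_ae_le_mul (g := fun x => f n x - f₀ x) (c := C)
      (ae_of_all _ fun x => ?_) 1).trans ?_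
    · simp only [Pi.sub_apply]
      rw [← inner_sub_left, mul_comm]
      exact (norm_inner_le_norm _ _).trans (by gcongr; exact hKC x)
    · gcongr
      exact eLpNorm_le_eLpNorm_mul_rpow_measure_univ (by norm_num) ((hf n).1.sub hf₀.1)
  refine tendsto_of_tendsto_of_tendsto_of_le_of_le tendsto_const_nhds ?_ (fun _ => zero_le) hbound
  have hfin : m Set.univ ^ (1 / (1 : ENNReal).toReal - 1 / (2 : ENNReal).toReal) ≠ ⊤ :=
    ENNReal.rpow_ne_top_of_nonneg (by norm_num) (measure_ne_top m _)
  have h1 := ENNReal.Tendsto.mul_const (b := m Set.univ ^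
    (1 / (1 : ENNReal).toReal - 1 / (2 : ENNReal).toReal)) h (Or.inr hfin)
  have h2 := ENNReal.Tendsto.const_mul (a := ENNReal.ofReal C) h1 (Or.inr ENNReal.ofReal_ne_top)
  simpa using h2

/-- For `u ∈ H¹₀` the Laplacian of a radial test function can be moved onto `u`. -/
theorem HasH10Gradient.setIntegral_inner_radialFun {N : ℕ} {Ω : Set (EuclideanSpace ℝ (Fin N))}
    (hΩ : Ω ⊆ ball 0 1) {u : EuclideanSpace ℝ (Fin N) → ℝ}
    {G : EuclideanSpace ℝ (Fin N) → EuclideanSpace ℝ (Fin N)} (hu : HasH10Gradient Ω u G)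
    {g : ℝ → ℝ} (hg : ContDiff ℝ ∞ g) (hφ : IsTestFunction Ω (radialFun N g)) :
    ∫ x in Ω, inner ℝ (G x) (gradient (radialFun N g) x) =
      -∫ x in Ω, u x * radialLaplacian N g (‖x‖ ^ 2) := by
  obtain ⟨hu2, hG2, φ, hφn, hlim, hlim'⟩ := hu
  have : IsFiniteMeasure (volume.restrict Ω) :=
    isFiniteMeasure_restrict.2 (measure_ne_top_of_subset hΩ measure_ball_lt_top.ne)
  have hLc : Continuous fun x : EuclideanSpace ℝ (Fin N) => radialLaplacian N g (‖x‖ ^ 2) :=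
    (continuous_radialLaplacian hg).comp (by fun_prop)
  have hgc := continuous_gradient hφ.1
  obtain ⟨C₁, hC₁⟩ := (hasCompactSupport_gradient hφ.2.1).exists_bound_of_continuous hgc
  have hLs : HasCompactSupport fun x : EuclideanSpace ℝ (Fin N) =>
      radialLaplacian N g (‖x‖ ^ 2) :=
    HasCompactSupport.intro hφ.2.1.isCompact fun x hx =>
      radialLaplacian_eq_zero_of_notMem_tsupport hg hx
  obtain ⟨C₂, hC₂⟩ := hLs.exists_bound_of_continuous hLc
  have h1 := tendsto_integral_inner_of_eLpNorm (fun n => (hφn n).memLp_gradient) hG2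
    hgc.aestronglyMeasurable hC₁ hlim'
  have h2 := (tendsto_integral_inner_of_eLpNorm (fun n => (hφn n).memLp) hu2
    hLc.aestronglyMeasurable hC₂ hlim).neg
  have heq : ∀ n, ∫ x in Ω, inner ℝ (gradient (φ n) x) (gradient (radialFun N g) x)
      = -∫ x in Ω, inner ℝ (φ n x) (radialLaplacian N g (‖x‖ ^ 2)) := by
    intro n
    rw [setIntegral_eq_integral_of_forall_compl_eq_zero, setIntegral_eq_integral_of_forall_compl_eq_zero,
      integral_inner_gradient_radialFun (hφn n).1 hg (Or.inr hφ.2.1)]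
    · simp [mul_comm]
    · intro x hx
      simp [(hφn n).eq_zero hx]
    · intro x hx
      simp [hφ.gradient_eq_zero hx]
  simp_rw [heq] at h1
  have := tendsto_nhds_unique h1 h2
  rw [this]
  simp [mul_comm]

theorem eLpNorm_two_eq_ofReal_sqrt {X F : Type*} [MeasurableSpace X] {m : Measure X}
    [NormedAddCommGroup F] {f : X → F} (hf : MemLp f 2 m) :
    eLpNorm f 2 m = ENNReal.ofReal √(∫ x, ‖f x‖ ^ 2 ∂m) := by
  rw [hf.eLpNorm_eq_integral_rpow_norm (by norm_num) (by norm_num), Real.sqrt_eq_rpow]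
  norm_num

/-- A Poincaré inequality on test functions extends to `H¹₀`. -/
theorem HasH10Gradient.mul_setIntegral_sq_le {N : ℕ} {Ω : Set (EuclideanSpace ℝ (Fin N))}
    {u : EuclideanSpace ℝ (Fin N) → ℝ}
    {G : EuclideanSpace ℝ (Fin N) → EuclideanSpace ℝ (Fin N)} (hu : HasH10Gradient Ω u G)
    {c : ℝ} (hc : 0 ≤ c) (h : ∀ φ, IsTestFunction Ω φ →
      c * ∫ x in Ω, φ x ^ 2 ≤ ∫ x in Ω, ‖gradient φ x‖ ^ 2) :
    c * ∫ x in Ω, u x ^ 2 ≤ ∫ x in Ω, ‖G x‖ ^ 2 := by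
  obtain ⟨hu2, hG2, φ, hφ, hlim, hlim'⟩ := hu
  set m := volume.restrict Ω
  set K := ENNReal.ofReal √c
  have htest : ∀ n, K * eLpNorm (φ n) 2 m ≤ eLpNorm (gradient (φ n)) 2 m := by
    intro n
    rw [eLpNorm_two_eq_ofReal_sqrt (hφ n).memLp, eLpNorm_two_eq_ofReal_sqrt (hφ n).memLp_gradient,
      ← ENNReal.ofReal_mul (Real.sqrt_nonneg _), ← Real.sqrt_mul hc]
    exact ENNReal.ofReal_le_ofReal (Real.sqrt_le_sqrt (by simpa using h _ (hφ n)))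
  have hlimit : K * eLpNorm u 2 m ≤ eLpNorm G 2 m := by
    have hn : ∀ n, K * eLpNorm u 2 m ≤ K * eLpNorm (fun x => φ n x - u x) 2 m +
        (eLpNorm (fun x => gradient (φ n) x - G x) 2 m + eLpNorm G 2 m) := by
      intro n
      have h1 : eLpNorm u 2 m ≤ eLpNorm (fun x => φ n x - u x) 2 m + eLpNorm (φ n) 2 m := by
        have := eLpNorm_sub_le (f := φ n) (g := fun x => φ n x - u x) (p := 2)
          (hφ n).memLp.1 ((hφ n).memLp.1.sub hu2.1) (by norm_num)
        rw [add_comm]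
        convert this using 2
        ext x
        simp
      have h2 : eLpNorm (gradient (φ n)) 2 m
          ≤ eLpNorm (fun x => gradient (φ n) x - G x) 2 m + eLpNorm G 2 m := by
        have := eLpNorm_add_le (f := fun x => gradient (φ n) x - G x) (g := G) (p := 2)
          ((hφ n).memLp_gradient.1.sub hG2.1) hG2.1 (by norm_num)
        convert this using 2
        ext x
        simp
      calc K * eLpNorm u 2 m ≤ K * (eLpNorm (fun x => φ n x - u x) 2 m + eLpNorm (φ n) 2 m) := by
            gcongr
        _ = K * eLpNorm (fun x => φ n x - u x) 2 m + K * eLpNorm (φ n) 2 m := mul_add _ _ _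
        _ ≤ _ := by gcongr; exact (htest n).trans h2
    refine ge_of_tendsto' (x := atTop) ?_ hn
    have := (ENNReal.Tendsto.const_mul (a := K) hlim (Or.inr ENNReal.ofReal_ne_top)).add
      (hlim'.add_const (eLpNorm G 2 m))
    simpa using this
  rw [eLpNorm_two_eq_ofReal_sqrt hu2, eLpNorm_two_eq_ofReal_sqrt hG2,
    ← ENNReal.ofReal_mul (Real.sqrt_nonneg _), ← Real.sqrt_mul hc,
    ENNReal.ofReal_le_ofReal_iff (Real.sqrt_nonneg _),
    Real.sqrt_le_sqrt_iff (integral_nonneg fun x => by positivity)] at hlimit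
  simpa using hlimit

/-! ### A lower bound for the first eigenvalue -/

/-- Picone's inequality `⟪∇(φ²/e), ∇e⟫ ≤ |∇φ|²`, where `e ≠ 0`. -/
theorem inner_gradient_sq_div_le {N : ℕ} {φ e : EuclideanSpace ℝ (Fin N) → ℝ}
    {x : EuclideanSpace ℝ (Fin N)} (hφ : DifferentiableAt ℝ φ x) (he : DifferentiableAt ℝ e x)
    (hx : e x ≠ 0) :
    inner ℝ (gradient (fun y => φ y ^ 2 / e y) x) (gradient e x) ≤ ‖gradient φ x‖ ^ 2 := by
  have hgrad : gradient (fun y => φ y ^ 2 / e y) x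
      = (2 * (φ x / e x)) • gradient φ x - (φ x / e x) ^ 2 • gradient e x := by
    refine ext_inner_left ℝ fun v => ?_
    rw [inner_sub_right, inner_smul_right, inner_smul_right, inner_gradient_right,
      inner_gradient_right, inner_gradient_right]
    have h := (hφ.hasFDerivAt.pow 2).mul
      ((hasDerivAt_inv hx).comp_hasFDerivAt x he.hasFDerivAt)
    have h' : HasFDerivAt (fun y => φ y ^ 2 / e y) _ x := h
    rw [h'.fderiv]
    simp
    field_simp
    ring
  have h := sq_nonneg ‖gradient φ x - (φ x / e x) • gradient e x‖
  rw [norm_sub_sq_real, inner_smul_right, norm_smul, mul_pow, Real.norm_eq_abs, sq_abs] at h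
  rw [hgrad, inner_sub_left, inner_smul_left, inner_smul_left, real_inner_self_eq_norm_sq]
  simp only [conj_trivial]
  linarith

/-- Barta's bound: a positive radial `e` with `-Δ e = c e` in the unit ball gives the Poincaré
inequality with constant `c` on test functions. -/
theorem mul_integral_sq_le_of_eigenfunction {N : ℕ} {g : ℝ → ℝ} (hg : ContDiff ℝ ∞ g) {c : ℝ}
    (hpos : ∀ s, 0 ≤ s → s < 1 → 0 < g s) (heig : ∀ s, radialLaplacian N g s = -c * g s)
    {Ω : Set (EuclideanSpace ℝ (Fin N))} (hΩ : Ω ⊆ ball 0 1) {φ : EuclideanSpace ℝ (Fin N) → ℝ}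
    (hφ : IsTestFunction Ω φ) :
    c * ∫ x in Ω, φ x ^ 2 ≤ ∫ x in Ω, ‖gradient φ x‖ ^ 2 := by
  set e := radialFun N g
  have hepos : ∀ x ∈ ball (0 : EuclideanSpace ℝ (Fin N)) 1, e x ≠ 0 := fun x hx =>
    (hpos _ (by positivity) ((sq_lt_one_iff₀ (norm_nonneg x)).2 (mem_ball_zero_iff.1 hx))).ne'
  have he : ContDiff ℝ ∞ e := contDiff_radialFun hg
  have hη : ContDiff ℝ ∞ fun y => φ y ^ 2 / e y := by
    refine contDiff_iff_contDiffAt.2 fun x => ?_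
    by_cases hx : x ∈ ball (0 : EuclideanSpace ℝ (Fin N)) 1
    · exact (hφ.1.contDiffAt.pow 2).div he.contDiffAt (hepos x hx)
    · have hx' : x ∉ tsupport φ := fun h => hx (hΩ (hφ.2.2 h))
      refine (contDiffAt_const (c := (0 : ℝ))).congr_of_eventuallyEq ?_
      filter_upwards [notMem_tsupport_iff_eventuallyEq.1 hx'] with y hy
      simp [hy]
  have hηc : HasCompactSupport fun y => φ y ^ 2 / e y :=
    hφ.2.1.mono fun y hy h => hy (by simp [h])
  have hibp := integral_inner_gradient_radialFun hη hg (Or.inl hηc)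
  rw [setIntegral_eq_integral_of_forall_compl_eq_zero (fun x hx => by simp [hφ.eq_zero hx]),
    setIntegral_eq_integral_of_forall_compl_eq_zero (fun x hx => by simp [hφ.gradient_eq_zero hx])]
  calc c * ∫ x, φ x ^ 2 = ∫ x, inner ℝ (gradient (fun y => φ y ^ 2 / e y) x) (gradient e x) := by
        rw [hibp, ← integral_const_mul, ← integral_neg]
        refine integral_congr_ae (ae_of_all _ fun x => ?_)
        simp only [heig]
        by_cases hx : x ∈ ball (0 : EuclideanSpace ℝ (Fin N)) 1
        · have := hepos x hx
          change _ = -(φ x ^ 2 / e x * (-c * e x))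
          field_simp
        · simp [hφ.eq_zero fun h => hx (hΩ h)]
    _ ≤ ∫ x, ‖gradient φ x‖ ^ 2 := by
        have hgφ := continuous_gradient hφ.1
        have hgc := hasCompactSupport_gradient hφ.2.1
        refine integral_mono ?_ ?_ fun x => ?_
        · refine ((continuous_gradient hη).inner
            (continuous_gradient he)).integrable_of_hasCompactSupport ?_
          exact (hasCompactSupport_gradient hηc).mono fun x hx h => hx (by simp [h])
        · refine (hgφ.norm.pow 2).integrable_of_hasCompactSupport ?_
          exact hgc.mono fun x hx h => hx (by simp [h])
        · by_cases hx : x ∈ ball (0 : EuclideanSpace ℝ (Fin N)) 1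
          · exact inner_gradient_sq_div_le (hφ.1.differentiable (by simp) x)
              (he.differentiable (by simp) x) (hepos x hx)
          · have hsub : (Function.support fun y => φ y ^ 2 / e y) ⊆ Function.support φ :=
              fun y hy h => hy (by simp [h])
            have hx' : x ∉ tsupport fun y => φ y ^ 2 / e y := fun h =>
              hx (hΩ (hφ.2.2 (closure_mono hsub h)))
            simp only [gradient_eq_zero_of_notMem_tsupport hx', inner_zero_left]
            positivity

theorem IsTestFunction.not_ae_eq_zero {N : ℕ} {Ω : Set (EuclideanSpace ℝ (Fin N))} (hΩ : IsOpen Ω)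
    {φ : EuclideanSpace ℝ (Fin N) → ℝ} (hφ : IsTestFunction Ω φ)
    (hne : ∃ x ∈ Ω, φ x ≠ 0) : ¬ φ =ᵐ[volume.restrict Ω] 0 := by
  obtain ⟨x, hx, hφx⟩ := hne
  intro h
  refine hφx (MeasureTheory.Measure.eqOn_open_of_ae_eq h hΩ hφ.1.continuous.continuousOn
    continuousOn_const hx)

/-- The eigenvalue of a positive radial eigenfunction is at most the infimum of the Rayleigh
quotient. -/
theorem le_firstEigenvalue {N : ℕ} (hN : N ≠ 0) (α : ℝ) {g : ℝ → ℝ} (hg : ContDiff ℝ ∞ g) {c : ℝ}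
    (hc : 0 ≤ c) (hpos : ∀ s, 0 ≤ s → s < 1 → 0 < g s)
    (heig : ∀ s, radialLaplacian N g s = -c * g s) : c ≤ firstEigenvalue (domain N α) := by
  refine le_csInf ?_ ?_
  · obtain ⟨b, -, -, hφ, hne⟩ := exists_radial_bump N hN α
    exact ⟨_, radialFun N b, _, hφ.hasH10Gradient, ⟨fun r => b (r ^ 2), ae_of_all _ fun x => rfl⟩,
      hφ.not_ae_eq_zero (isOpen_domain N α) hne, rfl⟩
  · rintro q ⟨u, G, hu, -, hne, rfl⟩
    have h := hu.mul_setIntegral_sq_le hc fun φ hφ =>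
      mul_integral_sq_le_of_eigenfunction hg hpos heig (domain_subset_ball N α) hφ
    have hpos : 0 < ∫ x in domain N α, u x ^ 2 := by
      refine lt_of_le_of_ne (integral_nonneg fun x => by positivity) fun h0 => hne ?_
      have := (integral_eq_zero_iff_of_nonneg (fun x => by positivity) hu.1.integrable_sq).1 h0.symm
      filter_upwards [this] with x hx
      simpa using hx
    rwa [le_div_iff₀ hpos]

/-! ### Truncated eigenfunctions -/

/-- A smooth convex approximation of the positive part `t ↦ max t 0`, within distance `ε`. -/
noncomputable def smoothPosPart (ε t : ℝ) : ℝ := ∫ τ in (0 : ℝ)..t, Real.smoothTransition (τ / ε)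

theorem hasDerivAt_smoothPosPart (ε t : ℝ) :
    HasDerivAt (smoothPosPart ε) (Real.smoothTransition (t / ε)) t := by
  have hc : Continuous fun τ : ℝ => Real.smoothTransition (τ / ε) :=
    Real.smoothTransition.continuous.comp (continuous_id.div_const ε)
  exact intervalIntegral.integral_hasDerivAt_right (hc.intervalIntegrable _ _)
    (hc.stronglyMeasurableAtFilter _ _) hc.continuousAt

theorem deriv_smoothPosPart (ε : ℝ) :
    deriv (smoothPosPart ε) = fun t => Real.smoothTransition (t / ε) :=
  funext fun t => (hasDerivAt_smoothPosPart ε t).deriv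

theorem contDiff_smoothTransition_div (ε : ℝ) :
    ContDiff ℝ ∞ fun t : ℝ => Real.smoothTransition (t / ε) :=
  Real.smoothTransition.contDiff.comp (contDiff_id.div_const ε)

theorem contDiff_smoothPosPart (ε : ℝ) : ContDiff ℝ ∞ (smoothPosPart ε) := by
  rw [contDiff_infty_iff_deriv, deriv_smoothPosPart]
  exact ⟨fun t => (hasDerivAt_smoothPosPart ε t).differentiableAt, contDiff_smoothTransition_div ε⟩

theorem monotone_smoothPosPart (ε : ℝ) : Monotone (smoothPosPart ε) :=
  monotone_of_deriv_nonneg (fun t => (hasDerivAt_smoothPosPart ε t).differentiableAt) fun t => by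
    rw [deriv_smoothPosPart]
    exact Real.smoothTransition.nonneg _

theorem smoothPosPart_of_nonpos {ε t : ℝ} (hε : 0 < ε) (ht : t ≤ 0) : smoothPosPart ε t = 0 := by
  rw [smoothPosPart, intervalIntegral.integral_symm, neg_eq_zero]
  refine (intervalIntegral.integral_congr fun τ hτ => ?_).trans intervalIntegral.integral_zero
  rw [Set.uIcc_of_le ht] at hτ
  exact Real.smoothTransition.zero_of_nonpos (div_nonpos_of_nonpos_of_nonneg hτ.2 hε.le)

theorem smoothPosPart_nonneg {ε : ℝ} (hε : 0 < ε) (t : ℝ) : 0 ≤ smoothPosPart ε t := by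
  rcases le_total t 0 with h | h
  · exact (smoothPosPart_of_nonpos hε h).ge
  · exact (smoothPosPart_of_nonpos hε le_rfl).ge.trans (monotone_smoothPosPart ε h)

theorem antitone_smoothPosPart_sub (ε : ℝ) : Antitone fun t => smoothPosPart ε t - t := by
  have h : ∀ t, HasDerivAt (fun t => smoothPosPart ε t - t)
      (Real.smoothTransition (t / ε) - 1) t := fun t =>
    (hasDerivAt_smoothPosPart ε t).sub (hasDerivAt_id t)
  refine antitone_of_deriv_nonpos (fun t => (h t).differentiableAt) fun t => ?_
  rw [(h t).deriv]
  linarith [Real.smoothTransition.le_one (t / ε)]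

theorem smoothPosPart_le {ε t : ℝ} (hε : 0 < ε) (ht : 0 ≤ t) : smoothPosPart ε t ≤ t := by
  have := antitone_smoothPosPart_sub ε ht
  simp only [smoothPosPart_of_nonpos hε le_rfl] at this
  linarith

theorem sub_le_smoothPosPart {ε : ℝ} (hε : 0 < ε) (t : ℝ) : t - ε ≤ smoothPosPart ε t := by
  rcases le_total t ε with h | h
  · linarith [smoothPosPart_nonneg hε t]
  · -- The slope equals `1` beyond `ε`.
    have hmono : MonotoneOn (fun t => smoothPosPart ε t - t) (Set.Ici ε) := by
      have hd : ∀ t, HasDerivAt (fun t => smoothPosPart ε t - t)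
          (Real.smoothTransition (t / ε) - 1) t := fun t =>
        (hasDerivAt_smoothPosPart ε t).sub (hasDerivAt_id t)
      refine monotoneOn_of_deriv_nonneg (convex_Ici ε)
        (fun t _ => (hd t).continuousAt.continuousWithinAt)
        (fun t _ => (hd t).differentiableAt.differentiableWithinAt) fun t ht => ?_
      have ht : ε ≤ t := interior_subset ht
      rw [(hd t).deriv, Real.smoothTransition.one_of_one_le ((one_le_div hε).2 ht), sub_self]
    have := hmono Set.self_mem_Ici h h
    simp only at this
    linarith [smoothPosPart_nonneg hε ε]

/-- The profile of a truncation of the eigenfunction `P (|x|²)`. Subtracting the superharmonic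
`ε (1 - log |x|²)` makes the function negative near the origin and near the unit sphere, so that
after composition with the convex `smoothPosPart ε` it is compactly supported in the punctured
ball and still a subsolution. -/
noncomputable def truncProfile (P : ℝ → ℝ) (ε s : ℝ) : ℝ :=
  if 0 < s ∧ s < 1 then smoothPosPart ε (P s + ε * (Real.log s - 1)) else 0

section truncProfile

variable {P : ℝ → ℝ} {ε : ℝ}

theorem truncProfile_nonneg (hε : 0 < ε) (s : ℝ) : 0 ≤ truncProfile P ε s := by
  unfold truncProfile
  split_ifs
  exacts [smoothPosPart_nonneg hε _, le_rfl]

theorem truncProfile_le (hε : 0 < ε) {s : ℝ} (hP : 0 ≤ P s) : truncProfile P ε s ≤ P s := by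
  unfold truncProfile
  split_ifs with hs
  · refine (monotone_smoothPosPart ε ?_).trans (smoothPosPart_le hε hP)
    nlinarith [Real.log_nonpos hs.1.le hs.2.le]
  · exact hP

theorem le_truncProfile (hε : 0 < ε) {s : ℝ} (hs : 0 < s) (hs1 : s < 1) :
    P s + ε * (Real.log s - 2) ≤ truncProfile P ε s := by
  rw [truncProfile, if_pos ⟨hs, hs1⟩]
  refine le_trans (le_of_eq ?_) (sub_le_smoothPosPart hε _)
  ring

theorem exists_truncProfile_eq_zero (hP : Continuous P) (hP1 : P 1 = 0) (hε : 0 < ε) :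
    ∃ s₁ s₂, 0 < s₁ ∧ s₂ < 1 ∧ ∀ s, s ∉ Set.Icc s₁ s₂ → truncProfile P ε s = 0 := by
  have h0 : ∀ᶠ s in 𝓝[>] (0 : ℝ), P s + ε * (Real.log s - 1) < 0 := by
    have h1 : Tendsto (fun s => Real.log s - 1) (𝓝[>] (0 : ℝ)) atBot :=
      tendsto_atBot_add_const_right _ (-1) Real.tendsto_log_nhdsGT_zero
    have h2 := (hP.tendsto 0).mono_left (nhdsWithin_le_nhds (s := Set.Ioi 0))
    exact (h2.add_atBot (h1.const_mul_atBot hε)).eventually (eventually_lt_atBot 0)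
  have h1 : ∀ᶠ s in 𝓝[<] (1 : ℝ), P s + ε * (Real.log s - 1) < 0 := by
    have hc : ContinuousAt (fun s => P s + ε * (Real.log s - 1)) 1 :=
      hP.continuousAt.add (continuousAt_const.mul
        ((Real.continuousAt_log one_ne_zero).sub continuousAt_const))
    refine Filter.Eventually.filter_mono nhdsWithin_le_nhds (hc.eventually_lt_const ?_)
    simp [hP1, hε]
  obtain ⟨s₁, hs₁, h0⟩ := mem_nhdsGT_iff_exists_Ioo_subset.1 h0
  obtain ⟨s₂, hs₂, h1⟩ := mem_nhdsLT_iff_exists_Ioo_subset.1 h1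
  refine ⟨s₁, s₂, hs₁, hs₂, fun s hs => ?_⟩
  unfold truncProfile
  split_ifs with h
  · refine smoothPosPart_of_nonpos hε (le_of_lt ?_)
    by_cases hs1 : s < s₁
    · exact h0 ⟨h.1, hs1⟩
    · exact h1 ⟨not_le.1 fun h2 => hs ⟨not_lt.1 hs1, h2⟩, h.2⟩
  · rfl

theorem contDiff_truncProfile (hP : ContDiff ℝ ∞ P) (hP1 : P 1 = 0) (hε : 0 < ε) :
    ContDiff ℝ ∞ (truncProfile P ε) := by
  obtain ⟨s₁, s₂, h1, h2, h0⟩ := exists_truncProfile_eq_zero hP.continuous hP1 hε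
  refine contDiff_iff_contDiffAt.2 fun s => ?_
  by_cases hs : s ∈ Set.Icc s₁ s₂
  · have hs0 : 0 < s := h1.trans_le hs.1
    have hc : ContDiffAt ℝ ∞ (fun s => smoothPosPart ε (P s + ε * (Real.log s - 1))) s :=
      (contDiff_smoothPosPart ε).contDiffAt.comp s <| hP.contDiffAt.add <|
        contDiffAt_const.mul ((Real.contDiffAt_log.2 hs0.ne').sub contDiffAt_const)
    refine hc.congr_of_eventuallyEq ?_
    filter_upwards [Ioo_mem_nhds hs0 (hs.2.trans_lt h2)] with t ht
    exact if_pos ht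
  · refine (contDiffAt_const (c := (0 : ℝ))).congr_of_eventuallyEq ?_
    filter_upwards [isClosed_Icc.isOpen_compl.mem_nhds hs] with t ht
    exact h0 t ht

/-- The truncations are subsolutions: `-Δ ≤ c P`. -/
theorem neg_radialLaplacian_truncProfile_le {N : ℕ} (hN : 2 ≤ N) (hP : ContDiff ℝ ∞ P)
    (hP1 : P 1 = 0) {c : ℝ} (hc : 0 ≤ c) (hpos : ∀ s, 0 ≤ s → s < 1 → 0 < P s)
    (heig : ∀ s, radialLaplacian N P s = -c * P s) (hε : 0 < ε) {s : ℝ} (hs : 0 ≤ s) (hs1 : s < 1) :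
    -radialLaplacian N (truncProfile P ε) s ≤ c * P s := by
  have hcP : 0 ≤ c * P s := mul_nonneg hc (hpos s hs hs1).le
  rcases hs.eq_or_lt with rfl | hs0
  · obtain ⟨s₁, s₂, h1, h2, h0⟩ := exists_truncProfile_eq_zero hP.continuous hP1 hε
    have hev : truncProfile P ε =ᶠ[𝓝 0] fun _ => 0 := by
      filter_upwards [Iio_mem_nhds h1] with t ht
      exact h0 t fun h => not_lt.2 h.1 ht
    rw [radialLaplacian, hev.deriv_eq]
    simpa using hcP
  have hP' : ContDiff ℝ ∞ (deriv P) := (contDiff_infty_iff_deriv.1 hP).2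
  let σ : ℝ → ℝ := fun t => Real.smoothTransition (t / ε)
  have hσ : ContDiff ℝ ∞ σ := contDiff_smoothTransition_div ε
  let h : ℝ → ℝ := fun s => P s + ε * (Real.log s - 1)
  have hd1 : ∀ t, 0 < t → HasDerivAt h (deriv P t + ε * t⁻¹) t := fun t ht =>
    (hP.differentiable (by simp) t).hasDerivAt.add
      (((Real.hasDerivAt_log ht.ne').sub_const 1).const_mul ε)
  have hd2 : HasDerivAt (fun t => deriv P t + ε * t⁻¹) (deriv (deriv P) s + ε * -(s ^ 2)⁻¹) s :=
    (hP'.differentiable (by simp) s).hasDerivAt.add ((hasDerivAt_inv hs0.ne').const_mul ε)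
  have hder : ∀ t, t ∈ Set.Ioo (0 : ℝ) 1 →
      deriv (truncProfile P ε) t = σ (h t) * (deriv P t + ε * t⁻¹) := by
    intro t ht
    have hev : truncProfile P ε =ᶠ[𝓝 t] smoothPosPart ε ∘ h := by
      filter_upwards [Ioo_mem_nhds ht.1 ht.2] with y hy
      exact if_pos hy
    rw [hev.deriv_eq]
    exact ((hasDerivAt_smoothPosPart ε (h t)).comp t (hd1 t ht.1)).deriv
  have hder2 : deriv (deriv (truncProfile P ε)) s
      = deriv σ (h s) * (deriv P s + ε * s⁻¹) * (deriv P s + ε * s⁻¹)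
        + σ (h s) * (deriv (deriv P) s + ε * -(s ^ 2)⁻¹) := by
    have hev : deriv (truncProfile P ε) =ᶠ[𝓝 s] fun t => σ (h t) * (deriv P t + ε * t⁻¹) := by
      filter_upwards [Ioo_mem_nhds hs0 hs1] with y hy
      exact hder y hy
    rw [hev.deriv_eq]
    exact (((hσ.differentiable (by simp) (h s)).hasDerivAt.comp s (hd1 s hs0)).mul hd2).deriv
  have hσ' : 0 ≤ deriv σ (h s) :=
    Monotone.deriv_nonneg fun x y hxy => Real.smoothTransition.monotone (by gcongr)
  have hσ0 : 0 ≤ σ (h s) := Real.smoothTransition.nonneg _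
  have hσ1 : σ (h s) ≤ 1 := Real.smoothTransition.le_one _
  have hN' : (2 : ℝ) ≤ N := by exact_mod_cast hN
  have key : radialLaplacian N (truncProfile P ε) s
      = 4 * s * (deriv σ (h s) * (deriv P s + ε * s⁻¹) ^ 2)
        + σ (h s) * (radialLaplacian N P s + ε * (2 * N - 4) * s⁻¹) := by
    rw [radialLaplacian, hder2, hder s ⟨hs0, hs1⟩, radialLaplacian]
    field_simp
    ring
  rw [key, heig]
  have t1 : 0 ≤ 4 * s * (deriv σ (h s) * (deriv P s + ε * s⁻¹) ^ 2) := by positivity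
  have t2 : 0 ≤ σ (h s) * (ε * (2 * N - 4) * s⁻¹) := by
    have : (0 : ℝ) ≤ 2 * N - 4 := by linarith
    positivity
  have t3 : σ (h s) * (c * P s) ≤ c * P s := mul_le_of_le_one_left hcP hσ1
  linarith

end truncProfile

/-! ### Comparison with the eigenfunction -/

theorem IsTestFunction.integrableOn_mul {N : ℕ} {Ω : Set (EuclideanSpace ℝ (Fin N))}
    {φ f : EuclideanSpace ℝ (Fin N) → ℝ} (hφ : IsTestFunction Ω φ)
    (hf : LocallyIntegrableOn f Ω volume) : IntegrableOn (fun x => f x * φ x) Ω := by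
  have hK : IsCompact (tsupport φ) := hφ.2.1.isCompact
  have h1 : IntegrableOn (fun x => f x * φ x) (tsupport φ) :=
    (hf.integrableOn_compact_subset hφ.2.2 hK).mul_continuousOn hφ.1.continuous.continuousOn hK
  refine Integrable.integrableOn ?_
  refine (integrableOn_iff_integrable_of_support_subset fun x hx => ?_).1 h1
  exact subset_tsupport φ fun h => hx (by simp [h])

/-- If `u ≥ 0` solves `-Δ u = f ≥ c u` weakly in `Ω`, where `c` is the eigenvalue of a positive
radial eigenfunction vanishing on the unit sphere, then `f = c u`: this is what remains after
testing with the eigenfunction. -/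
theorem ae_eq_mul_of_weak_supersolution {N : ℕ} (hN : 2 ≤ N) {α : ℝ} {P : ℝ → ℝ}
    (hP : ContDiff ℝ ∞ P) (hP1 : P 1 = 0) {c : ℝ} (hc : 0 ≤ c)
    (hpos : ∀ s, 0 ≤ s → s < 1 → 0 < P s) (heig : ∀ s, radialLaplacian N P s = -c * P s)
    {u f : EuclideanSpace ℝ (Fin N) → ℝ} {G : EuclideanSpace ℝ (Fin N) → EuclideanSpace ℝ (Fin N)}
    (hu : HasH10Gradient (domain N α) u G) (hf : LocallyIntegrableOn f (domain N α) volume)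
    (heq : ∀ φ, IsTestFunction (domain N α) φ →
      ∫ x in domain N α, inner ℝ (G x) (gradient φ x) = ∫ x in domain N α, f x * φ x)
    (hu0 : ∀ᵐ x ∂(volume.restrict (domain N α)), 0 ≤ u x)
    (hfu : ∀ᵐ x ∂(volume.restrict (domain N α)), c * u x ≤ f x) :
    ∀ᵐ x ∂(volume.restrict (domain N α)), f x = c * u x := by
  set Ω := domain N α
  have hΩ : Ω ⊆ ball 0 1 := domain_subset_ball N α
  have hΩm : MeasurableSet Ω := measurableSet_domain N α
  have : IsFiniteMeasure (volume.restrict Ω) :=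
    isFiniteMeasure_restrict.2 (measure_ne_top_of_subset hΩ measure_ball_lt_top.ne)
  have : NeZero N := ⟨by omega⟩
  have hmem : ∀ᵐ x ∂(volume.restrict Ω), ‖x‖ ^ 2 < 1 := by
    filter_upwards [ae_restrict_mem hΩm] with x hx
    exact (sq_lt_one_iff₀ (norm_nonneg x)).2 (mem_ball_zero_iff.1 (hΩ hx))
  have hne : ∀ᵐ x ∂(volume.restrict Ω), 0 < ‖x‖ ^ 2 := by
    filter_upwards [ae_restrict_of_ae (Measure.ae_ne volume (0 : EuclideanSpace ℝ (Fin N)))]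
      with x hx
    positivity
  have hui : Integrable u (volume.restrict Ω) := hu.1.integrable (by norm_num)
  set e := radialFun N P
  have hec : Continuous e := (contDiff_radialFun hP).continuous
  obtain ⟨C, hC⟩ := (isCompact_closedBall (0 : EuclideanSpace ℝ (Fin N)) 1).exists_bound_of_continuousOn
    hec.continuousOn
  have heC : ∀ᵐ x ∂(volume.restrict Ω), ‖e x‖ ≤ C := by
    filter_upwards [ae_restrict_mem hΩm] with x hx
    exact hC x (ball_subset_closedBall (hΩ hx))
  have hue : Integrable (fun x => u x * e x) (volume.restrict Ω) :=
    hui.mul_bdd hec.aestronglyMeasurable heC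
  let ε : ℕ → ℝ := fun n => 1 / ((n : ℝ) + 1)
  have hε : ∀ n, 0 < ε n := fun n => by positivity
  have hε0 : Tendsto ε atTop (𝓝 0) := tendsto_one_div_add_atTop_nhds_zero_nat
  let φ : ℕ → EuclideanSpace ℝ (Fin N) → ℝ := fun n => radialFun N (truncProfile P (ε n))
  have hgc : ∀ n, ContDiff ℝ ∞ (truncProfile P (ε n)) := fun n => contDiff_truncProfile hP hP1 (hε n)
  have hφ : ∀ n, IsTestFunction Ω (φ n) := fun n => by
    obtain ⟨s₁, s₂, h1, h2, h0⟩ := exists_truncProfile_eq_zero hP.continuous hP1 (hε n)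
    exact isTestFunction_radialFun N α (hgc n) h1 h2 h0
  have hφ0 : ∀ n x, 0 ≤ φ n x := fun n x => truncProfile_nonneg (hε n) _
  have hφe : ∀ n, ∀ᵐ x ∂(volume.restrict Ω), φ n x ≤ e x := fun n => by
    filter_upwards [hmem] with x hx
    exact truncProfile_le (hε n) (hpos _ (by positivity) hx).le
  have hφlim : ∀ᵐ x ∂(volume.restrict Ω), Tendsto (fun n => φ n x) atTop (𝓝 (e x)) := by
    filter_upwards [hmem, hne, ae_all_iff.2 hφe] with x hx hx0 hxe
    refine tendsto_of_tendsto_of_tendsto_of_le_of_le (g := fun n =>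
      P (‖x‖ ^ 2) + ε n * (Real.log (‖x‖ ^ 2) - 2)) ?_ tendsto_const_nhds
      (fun n => le_truncProfile (hε n) hx0 hx) hxe
    have hl := (hε0.mul_const (Real.log (‖x‖ ^ 2) - 2)).const_add (P (‖x‖ ^ 2))
    rwa [zero_mul, add_zero] at hl
  have huφ : ∀ n, Integrable (fun x => u x * φ n x) (volume.restrict Ω) := fun n =>
    hue.mono' (hui.1.mul (hφ n).1.continuous.aestronglyMeasurable) (by
      filter_upwards [hu0, hφe n] with x hx hxe
      rw [Real.norm_of_nonneg (mul_nonneg hx (hφ0 n x))]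
      gcongr)
  have hfφ : ∀ n, Integrable (fun x => f x * φ n x) (volume.restrict Ω) := fun n =>
    (hφ n).integrableOn_mul hf
  -- Testing the equation with the truncated eigenfunctions.
  have htest : ∀ n, ∫ x in Ω, f x * φ n x ≤ c * ∫ x in Ω, u x * e x := by
    intro n
    rw [← heq _ (hφ n), hu.setIntegral_inner_radialFun hΩ (hgc n) (hφ n), ← integral_neg,
      ← integral_const_mul]
    have hLc : Continuous fun x : EuclideanSpace ℝ (Fin N) =>
        radialLaplacian N (truncProfile P (ε n)) (‖x‖ ^ 2) :=
      (continuous_radialLaplacian (hgc n)).comp (by fun_prop)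
    obtain ⟨D, hD⟩ := (isCompact_closedBall (0 : EuclideanSpace ℝ (Fin N))
      1).exists_bound_of_continuousOn hLc.continuousOn
    have hLi : Integrable (fun x => u x * radialLaplacian N (truncProfile P (ε n)) (‖x‖ ^ 2))
        (volume.restrict Ω) := by
      refine hui.mul_bdd (c := D) hLc.aestronglyMeasurable ?_
      filter_upwards [ae_restrict_mem hΩm] with x hx
      exact hD x (ball_subset_closedBall (hΩ hx))
    refine integral_mono_ae hLi.neg (hue.const_mul c) ?_
    filter_upwards [hmem, hu0] with x hx hux
    have h := neg_radialLaplacian_truncProfile_le hN hP hP1 hc hpos heig (hε n)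
      (by positivity : 0 ≤ ‖x‖ ^ 2) hx
    have h' := mul_le_mul_of_nonneg_left h hux
    change -(u x * _) ≤ c * (u x * P (‖x‖ ^ 2))
    linarith
  set w : EuclideanSpace ℝ (Fin N) → ℝ := fun x => f x - c * u x
  have hwφ : ∀ n, Integrable (fun x => w x * φ n x) (volume.restrict Ω) := fun n =>
    ((hfφ n).sub ((huφ n).const_mul c)).congr (ae_of_all _ fun x => by
      simp only [Pi.sub_apply, w]
      ring)
  have hwφ0 : ∀ n, ∀ᵐ x ∂(volume.restrict Ω), 0 ≤ w x * φ n x := fun n => by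
    filter_upwards [hfu] with x hx
    exact mul_nonneg (sub_nonneg.2 hx) (hφ0 n x)
  have hwle : ∀ n, ∫ x in Ω, w x * φ n x ≤
      c * ((∫ x in Ω, u x * e x) - ∫ x in Ω, u x * φ n x) := by
    intro n
    have h : ∫ x in Ω, w x * φ n x = (∫ x in Ω, f x * φ n x) - c * ∫ x in Ω, u x * φ n x := by
      rw [← integral_const_mul, ← integral_sub (hfφ n) ((huφ n).const_mul c)]
      refine integral_congr_ae (ae_of_all _ fun x => ?_)
      simp only [w]
      ring
    linarith [htest n]
  have hlim : Tendsto (fun n => ∫ x in Ω, u x * φ n x) atTop (𝓝 (∫ x in Ω, u x * e x)) := by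
    refine tendsto_integral_of_dominated_convergence (fun x => u x * e x)
      (fun n => (huφ n).1) hue (fun n => ?_) ?_
    · filter_upwards [hu0, hφe n] with x hx hxe
      rw [Real.norm_of_nonneg (mul_nonneg hx (hφ0 n x))]
      gcongr
    · filter_upwards [hφlim] with x hx
      exact hx.const_mul _
  have hw0 : Tendsto (fun n => ∫ x in Ω, w x * φ n x) atTop (𝓝 0) := by
    refine tendsto_of_tendsto_of_tendsto_of_le_of_le tendsto_const_nhds ?_
      (fun n => integral_nonneg_of_ae (hwφ0 n)) hwle
    simpa using (hlim.const_sub (∫ x in Ω, u x * e x)).const_mul c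
  -- By Fatou's lemma the limit `w e` has vanishing integral.
  have hfatou : ∫⁻ x in Ω, ENNReal.ofReal (w x * e x) = 0 := by
    refine le_antisymm ?_ zero_le
    calc ∫⁻ x in Ω, ENNReal.ofReal (w x * e x)
        = ∫⁻ x in Ω, liminf (fun n => ENNReal.ofReal (w x * φ n x)) atTop := by
          refine lintegral_congr_ae ?_
          filter_upwards [hφlim] with x hx
          exact ((ENNReal.tendsto_ofReal (hx.const_mul (w x))).liminf_eq).symm
      _ ≤ liminf (fun n => ∫⁻ x in Ω, ENNReal.ofReal (w x * φ n x)) atTop :=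
          lintegral_liminf_le' fun n => (hwφ n).1.aemeasurable.ennreal_ofReal
      _ = 0 := by
          simp_rw [← fun n => ofReal_integral_eq_lintegral_ofReal (hwφ n) (hwφ0 n)]
          simpa using (ENNReal.tendsto_ofReal hw0).liminf_eq
  have hwm : AEMeasurable w (volume.restrict Ω) :=
    ((hf.aestronglyMeasurable).sub (hui.1.const_mul c)).aemeasurable
  have hae := (lintegral_eq_zero_iff' (hwm.mul hec.aemeasurable).ennreal_ofReal).1 hfatou
  filter_upwards [hae, hmem, hfu] with x hx hx1 hxf
  have hex : 0 < e x := hpos _ (by positivity) hx1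
  have h1 : w x * e x ≤ 0 := ENNReal.ofReal_eq_zero.1 hx
  have h2 : w x ≤ 0 := nonpos_of_mul_nonpos_left h1 hex
  simp only [w] at h2
  linarith

/-! ### The nonlinearity and the conclusion -/

/-- Pointwise lower bound for the nonlinearity. With `k = (α + 2) / (N - 2)` and `y = s ^ (2 k)` the
quotient by `s` is at least `y + (μ / k) log y + λ`, whose minimum is at `y = - μ / k`. -/
theorem mul_le_nonlinearity {N : ℕ} (hN : 3 ≤ N) {α lam μ c : ℝ} (hα : -2 < α) (hα' : α ≤ 0)
    (hμ : μ < 0) (h : c ≤ -(((N : ℝ) - 2) * μ / (α + 2))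
        + ((N : ℝ) - 2) * μ / (α + 2) * Real.log (-(((N : ℝ) - 2) * μ / (α + 2))) + lam)
    {x : EuclideanSpace ℝ (Fin N)} (hx0 : 0 < ‖x‖) (hx1 : ‖x‖ < 1) {s : ℝ} (hs : 0 < s) :
    c * s ≤ nonlinearity N α lam μ x s ∧ (nonlinearity N α lam μ x s = c * s →
      α = 0 ∧ s = (-(((N : ℝ) - 2) * μ / (α + 2))) ^ (critExp N α - 2)⁻¹) := by
  have hN' : (0 : ℝ) < N - 2 := by
    have : (3 : ℝ) ≤ N := by exact_mod_cast hN
    linarith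
  have hα2 : 0 < α + 2 := by linarith
  set q := -(((N : ℝ) - 2) * μ / (α + 2)) with hq
  have hqpos : 0 < q := by
    rw [hq, ← neg_div, ← mul_neg]
    exact div_pos (mul_pos hN' (by linarith)) hα2
  set p := critExp N α - 2 with hp
  have hp' : p = 2 * (α + 2) / (N - 2) := by
    rw [hp, critExp]
    field_simp
    ring
  have hppos : 0 < p := by
    rw [hp']
    positivity
  have hμq : μ * 2 = -q * p := by
    rw [hp', hq]
    field_simp
  set y := s ^ p with hy
  have hypos : 0 < y := Real.rpow_pos_of_pos hs p
  have hlogy : Real.log y = p * Real.log s := Real.log_rpow hs p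
  have hnl : nonlinearity N α lam μ x s = (‖x‖ ^ α * y - q * Real.log y + lam) * s := by
    rw [nonlinearity, abs_of_pos hs, Real.log_pow, hlogy]
    push_cast
    linear_combination (s * Real.log s) * hμq
  have hh : c ≤ q - q * Real.log q + lam := by
    have : ((N : ℝ) - 2) * μ / (α + 2) = -q := by rw [hq, neg_neg]
    rw [this] at h
    linarith
  have hlog : Real.log (y / q) = Real.log y - Real.log q := Real.log_div hypos.ne' hqpos.ne'
  have hmin : q - q * Real.log q ≤ y - q * Real.log y := by
    have h1 := Real.log_le_sub_one_of_pos (div_pos hypos hqpos)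
    have h2 := mul_le_mul_of_nonneg_left h1 hqpos.le
    rw [hlog, mul_sub, mul_sub, mul_div_cancel₀ _ hqpos.ne'] at h2
    linarith
  have hr : 1 ≤ ‖x‖ ^ α := Real.one_le_rpow_of_pos_of_le_one_of_nonpos hx0 hx1.le hα'
  have hry : y ≤ ‖x‖ ^ α * y := le_mul_of_one_le_left hypos.le hr
  refine ⟨?_, fun heq => ?_⟩
  · rw [hnl]
    exact mul_le_mul_of_nonneg_right (by linarith) hs.le
  · rw [hnl] at heq
    have heq' := mul_right_cancel₀ hs.ne' heq
    constructor
    · by_contra hne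
      have hr' : 1 < ‖x‖ ^ α :=
        Real.one_lt_rpow_of_pos_of_lt_one_of_neg hx0 hx1 (lt_of_le_of_ne hα' hne)
      have := lt_mul_of_one_lt_left hypos hr'
      linarith
    · have hyq : y = q := by
        by_contra hne
        have h1 := Real.log_lt_sub_one_of_pos (div_pos hypos hqpos)
          fun h => hne ((div_eq_one_iff_eq hqpos.ne').1 h)
        have h2 := mul_lt_mul_of_pos_left h1 hqpos
        rw [hlog, mul_sub, mul_sub, mul_div_cancel₀ _ hqpos.ne'] at h2
        linarith
      rw [← hyq, hy, Real.rpow_rpow_inv hs.le hppos.ne']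

/-- A nonzero constant does not satisfy `-Δ u = c u` weakly for `c > 0`. -/
theorem not_ae_eq_const {N : ℕ} (hN : N ≠ 0) {α : ℝ} {u f : EuclideanSpace ℝ (Fin N) → ℝ}
    {G : EuclideanSpace ℝ (Fin N) → EuclideanSpace ℝ (Fin N)}
    (hu : HasH10Gradient (domain N α) u G)
    (heq : ∀ φ, IsTestFunction (domain N α) φ →
      ∫ x in domain N α, inner ℝ (G x) (gradient φ x) = ∫ x in domain N α, f x * φ x)
    {c C : ℝ} (hc : 0 < c) (hC : 0 < C)
    (hf : ∀ᵐ x ∂(volume.restrict (domain N α)), f x = c * u x) :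
    ¬ ∀ᵐ x ∂(volume.restrict (domain N α)), u x = C := by
  intro huC
  obtain ⟨b, hb, hb0, hφ, hne⟩ := exists_radial_bump N hN α
  have h1 : ∫ x in domain N α, f x * radialFun N b x = c * C * ∫ x in domain N α, radialFun N b x := by
    rw [← integral_const_mul]
    refine integral_congr_ae ?_
    filter_upwards [hf, huC] with x hx hx'
    rw [hx, hx']
  have h2 : ∫ x in domain N α, u x * radialLaplacian N b (‖x‖ ^ 2) = 0 := by
    have h3 : ∫ x in domain N α, u x * radialLaplacian N b (‖x‖ ^ 2)
        = C * ∫ x in domain N α, radialLaplacian N b (‖x‖ ^ 2) := by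
      rw [← integral_const_mul]
      refine integral_congr_ae ?_
      filter_upwards [huC] with x hx
      rw [hx]
    have h4 := integral_inner_gradient_radialFun (N := N) (p := fun _ => 1) contDiff_const hb
      (Or.inr hφ.2.1)
    have h5 : ∀ x : EuclideanSpace ℝ (Fin N), gradient (fun _ => (1 : ℝ)) x = 0 := fun x => by
      simp [gradient]
    simp only [h5, inner_zero_left, integral_zero, one_mul] at h4
    rw [h3, setIntegral_eq_integral_of_forall_compl_eq_zero fun x hx =>
      radialLaplacian_eq_zero_of_notMem_tsupport hb fun h => hx (hφ.2.2 h)]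
    rw [neg_eq_zero.1 h4.symm, mul_zero]
  have h3 := heq _ hφ
  rw [hu.setIntegral_inner_radialFun (domain_subset_ball N α) hb hφ, h1, h2, neg_zero] at h3
  have h4 : ∫ x in domain N α, radialFun N b x = 0 :=
    (mul_eq_zero.1 h3.symm).resolve_left (mul_pos hc hC).ne'
  refine hφ.not_ae_eq_zero (isOpen_domain N α) hne ?_
  have hint : IntegrableOn (radialFun N b) (domain N α) :=
    (hφ.1.continuous.integrable_of_hasCompactSupport hφ.2.1).integrableOn
  exact (integral_eq_zero_iff_of_nonneg (fun x => hb0 _) hint).1 h4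

/-- A positive radial eigenfunction of the unit ball vanishing on its boundary. -/
theorem exists_radial_eigenfunction {N : ℕ} (hN : 2 ≤ N) :
    ∃ (P : ℝ → ℝ) (c : ℝ), 0 < c ∧ ContDiff ℝ ∞ P ∧ P 1 = 0 ∧
      (∀ s, 0 ≤ s → s < 1 → 0 < P s) ∧ ∀ s, radialLaplacian N P s = -c * P s := by
  have hN' : (2 : ℝ) ≤ N := by exact_mod_cast hN
  obtain ⟨J, a, ha, hJ, hode, hJa, hpos⟩ :=
    exists_bessel_profile_first_zero (ν := (N : ℝ) / 2) (by linarith)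
  have hJ' : ContDiff ℝ ∞ (deriv J) := (contDiff_infty_iff_deriv.1 hJ).2
  refine ⟨fun s => J (a * s), 4 * a, by positivity, hJ.comp (contDiff_const.mul contDiff_id),
    by simpa using hJa, fun s hs hs1 => hpos _ (by positivity) (by nlinarith), fun s => ?_⟩
  have h1 : deriv (fun s => J (a * s)) = fun s => a * deriv J (a * s) := by
    funext s
    simp [deriv_comp_mul_left]
  have h2 : deriv (fun s => a * deriv J (a * s)) s = a * (a * deriv (deriv J) (a * s)) := by
    have hd : DifferentiableAt ℝ (fun s => deriv J (a * s)) s :=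
      ((hJ'.comp (contDiff_const.mul contDiff_id)).differentiable (by simp)) s
    rw [deriv_const_mul _ hd]
    simp [deriv_comp_mul_left]
  rw [radialLaplacian, h1, h2]
  linear_combination 4 * a * hode (a * s)

end HardyHenon

theorem theorem1p4 (N : ℕ) (hN : 3 ≤ N) (α lam μ : ℝ) (hα : -2 < α) (hα' : α ≤ 0) (hμ : μ < 0)
    (h : 0 ≤ -(((N : ℝ) - 2) * μ / (α + 2))
        + ((N : ℝ) - 2) * μ / (α + 2) * Real.log (-(((N : ℝ) - 2) * μ / (α + 2)))
        + lam - HardyHenon.firstEigenvalue (HardyHenon.domain N α)) :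
    ¬ ∃ u : EuclideanSpace ℝ (Fin N) → ℝ, HardyHenon.IsPositiveSolution N α lam μ u := by
  open HardyHenon in
  rintro ⟨u, ⟨G, hu, hf, heq⟩, hupos⟩
  have hN0 : N ≠ 0 := by omega
  have : NeZero N := ⟨hN0⟩
  obtain ⟨P, c, hc, hP, hP1, hpos, heig⟩ := exists_radial_eigenfunction (N := N) (by omega)
  have hcle := le_firstEigenvalue hN0 α hP hc.le hpos heig
  have hpt : ∀ᵐ x ∂(volume.restrict (domain N α)), 0 < ‖x‖ ∧ ‖x‖ < 1 ∧ 0 < u x := by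
    filter_upwards [hupos, ae_restrict_mem (measurableSet_domain N α),
      ae_restrict_of_ae (Measure.ae_ne volume (0 : EuclideanSpace ℝ (Fin N)))] with x hx hxm hx0
    exact ⟨norm_pos_iff.2 hx0, mem_ball_zero_iff.1 (domain_subset_ball N α hxm), hx⟩
  have hlow := fun (x : EuclideanSpace ℝ (Fin N)) (hx : 0 < ‖x‖ ∧ ‖x‖ < 1 ∧ 0 < u x) =>
    mul_le_nonlinearity hN hα hα' hμ (c := c) (lam := lam) (by linarith) hx.1 hx.2.1 hx.2.2
  have hfeq := ae_eq_mul_of_weak_supersolution (by omega) hP hP1 hc.le hpos heig hu hf heq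
    (hupos.mono fun x hx => hx.le) (hpt.mono fun x hx => (hlow x hx).1)
  have hconst : ∀ᵐ x ∂(volume.restrict (domain N α)),
      u x = (-(((N : ℝ) - 2) * μ / (α + 2))) ^ (critExp N α - 2)⁻¹ := by
    filter_upwards [hpt, hfeq] with x hx hx'
    exact ((hlow x hx).2 hx').2
  refine not_ae_eq_const hN0 hu heq hc (Real.rpow_pos_of_pos ?_ _) hfeq hconst
  have hN' : (0 : ℝ) < N - 2 := by
    have : (3 : ℝ) ≤ N := by exact_mod_cast hN
    linarith
  rw [← neg_div, ← mul_neg]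
  exact div_pos (mul_pos hN' (by linarith)) (by linarith)
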